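/- There are absolute constants $K, C > 0$ such that the following holds for all integers $d \ge 1$ and $n \ge K d^{4/3}$. Let $U = (u_1, \ldots, u_n)$ be a random frame, where $u_1, \ldots, u_n$ are independent random vectors, each uniformly distributed on the sphere of radius $\sqrt{d/n}$ centred at the origin of $\mathbb{R}^d$ (so $\|u_i\|_2^2 = d/n$). Then, with probability at least $0.99$, the following holds for every real $\varepsilon$: if $$(1-\varepsilon) I_d \preceq \sum_{i=1}^n u_i u_i^* \preceq (1+\varepsilon) I_d,$$ then there is a frame $V = (v_1, \ldots, v_n)$ of vectors in $\mathbb{R}^d$ with $$\sum_{i=1}^n v_i v_i^* = I_d, \qquad \|v_i\|_2^2 = \frac{d}{n} \ \text{ for } 1 \le i \le n, \qquad \text{and} \qquad \sum_{i=1}^n \|u_i - v_i\|_2^2 \le C\, d\, \varepsilon^2.$$ -/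

import Mathlib

open MeasureTheory ProbabilityTheory

noncomputable section

/-- The uniform probability measure on the sphere of radius `r` centred at the origin of `ℝ^d`,
as a measure on `ℝ^d`: the surface measure of the unit sphere, normalized to total mass one, is
pushed forward along `x ↦ r x`. It is meant for `1 ≤ d` and `0 ≤ r`. -/
def uniformSphere (d : ℕ) (r : ℝ) : Measure (EuclideanSpace ℝ (Fin d)) :=
  Measure.map
    (fun x : Metric.sphere (0 : EuclideanSpace ℝ (Fin d)) 1 => r • (x : EuclideanSpace ℝ (Fin d)))
    (((volume : Measure (EuclideanSpace ℝ (Fin d))).toSphere Set.univ)⁻¹ •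
      (volume : Measure (EuclideanSpace ℝ (Fin d))).toSphere)

/-- The frame operator `∑ i, u_i u_i^*` of `U = (u_1, …, u_n)`, a `d × d` matrix. -/
def frameOperator {d n : ℕ} (U : Fin n → EuclideanSpace ℝ (Fin d)) :
    Matrix (Fin d) (Fin d) ℝ :=
  ∑ i, Matrix.vecMulVec (U i).ofLp (U i).ofLp

/-- `(1 - ε) I_d ≼ ∑ i, u_i u_i^* ≼ (1 + ε) I_d` in the Loewner order. -/
def IsNearlyParseval {d n : ℕ} (ε : ℝ) (U : Fin n → EuclideanSpace ℝ (Fin d)) : Prop :=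
  (frameOperator U - (1 - ε) • (1 : Matrix (Fin d) (Fin d) ℝ)).PosSemidef ∧
    ((1 + ε) • (1 : Matrix (Fin d) (Fin d) ℝ) - frameOperator U).PosSemidef

/-- A doubly balanced frame of size `d`: it is Parseval and all its vectors have squared
Euclidean norm `d / n`. -/
def IsDoublyBalanced {d n : ℕ} (V : Fin n → EuclideanSpace ℝ (Fin d)) : Prop :=
  frameOperator V = 1 ∧ ∀ i, ‖V i‖ ^ 2 = (d : ℝ) / n

/-- The squared distance `∑ i, ‖u_i - v_i‖²` between two frames. -/
def frameDist {d n : ℕ} (U V : Fin n → EuclideanSpace ℝ (Fin d)) : ℝ :=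
  ∑ i, ‖U i - V i‖ ^ 2

end

/-!
Rescale the frame to unit vectors `x_i`, with the weight `d / n` in the frame operator. If `n` is a
large multiple of `d ^ (4 / 3)`, then with high probability two things hold. The frame operator is
within `O(√(d / n))` of the identity, by a Chernoff bound and a net. And there is a spectral gap: on
traceless symmetric matrices `X`, the quadratic form `(d / n) * ∑ i, ⟪x_i, X x_i⟫ ^ 2` is at most
`(3 / 4) ^ 2` times the squared Frobenius norm. The gap comes from Markov's inequality for the trace
of the fourth power of the centred sum of the outer squares of the matrices `x_i x_iᵀ - I / d`.

The frame `V` is the limit of the iteration which alternately makes the frame Parseval (by the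
inverse square root of its frame operator) and normalizes its vectors. To first order, one step
replaces the error `D` of the frame operator by `(d / n) * ∑ i, ⟪x_i, D x_i⟫ x_i x_iᵀ`, so the gap
makes the Frobenius norm of the error decay geometrically. The total squared movement is therefore
at most a constant times the squared Frobenius norm of the initial error, which is at most
`d * ε ^ 2`. The vectors move so little that the gap survives along the iteration, because
`√(d / n)` is small against `d ^ (- 1 / 6)`.
-/

section FrameOperators

open Module
open scoped RealInnerProductSpace

variable {E : Type*} [NormedAddCommGroup E] [InnerProductSpace ℝ E]
variable {ι κ : Type*} [Fintype ι] [Fintype κ]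

theorem norm_apply_le_of_abs_inner_self_le {T : E →ₗ[ℝ] E} (hT : T.IsSymmetric) {e : ℝ}
    (h : ∀ v, |⟪v, T v⟫| ≤ e * ‖v‖ ^ 2) (v : E) : ‖T v‖ ≤ e * ‖v‖ := by
  rcases eq_or_ne (T v) 0 with h0 | hTv
  · rcases eq_or_ne v 0 with rfl | hv
    · simp
    · have hv0 := norm_pos_iff.2 hv
      have : 0 ≤ e * ‖v‖ ^ 2 := (abs_nonneg _).trans (h v)
      rw [h0, norm_zero]
      exact mul_nonneg (nonneg_of_mul_nonneg_left this (by positivity)) hv0.le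
  have hTv0 : 0 < ‖T v‖ := norm_pos_iff.2 hTv
  set u := (‖v‖ / ‖T v‖) • T v
  have hu : ‖u‖ = ‖v‖ := by
    simp only [u, norm_smul, norm_div, norm_norm]
    field_simp
  have hvu : ⟪u, T v⟫ = ‖v‖ * ‖T v‖ := by
    simp only [u, inner_smul_left, real_inner_self_eq_norm_sq, conj_trivial]
    field_simp
  have polarization : ⟪u + v, T (u + v)⟫ - ⟪u - v, T (u - v)⟫ = 4 * ⟪u, T v⟫ := by
    have : ⟪v, T u⟫ = ⟪u, T v⟫ := by rw [← hT, real_inner_comm]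
    simp only [map_add, map_sub, inner_add_left, inner_add_right, inner_sub_left, inner_sub_right]
    linarith
  have parallelogram : ‖u + v‖ ^ 2 + ‖u - v‖ ^ 2 = 4 * ‖v‖ ^ 2 := by
    rw [norm_add_sq_real, norm_sub_sq_real, hu]
    ring
  have key : ‖v‖ * ‖T v‖ ≤ ‖v‖ * (e * ‖v‖) := by
    have h1 := (le_abs_self _).trans (h (u + v))
    have h2 := (neg_le_abs _).trans (h (u - v))
    have h3 : 4 * (‖v‖ * ‖T v‖) ≤ e * (‖u + v‖ ^ 2 + ‖u - v‖ ^ 2) := by linarith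
    rw [parallelogram] at h3
    linarith
  refine le_of_mul_le_mul_left key (norm_pos_iff.2 ?_)
  rintro rfl
  simp at hTv

section Frobenius

variable [FiniteDimensional ℝ E]

/-- The squared Frobenius (Hilbert-Schmidt) norm of an operator. -/
noncomputable def frobeniusSq (X : E →ₗ[ℝ] E) : ℝ := LinearMap.trace ℝ E (X.adjoint ∘ₗ X)

theorem frobeniusSq_eq_sum_norm_sq (b : OrthonormalBasis ι ℝ E) (X : E →ₗ[ℝ] E) :
    frobeniusSq X = ∑ a, ‖X (b a)‖ ^ 2 := by
  simp [frobeniusSq, LinearMap.trace_eq_sum_inner _ b, LinearMap.adjoint_inner_right]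

theorem frobeniusSq_nonneg (X : E →ₗ[ℝ] E) : 0 ≤ frobeniusSq X := by
  rw [frobeniusSq_eq_sum_norm_sq (stdOrthonormalBasis ℝ E)]
  positivity

theorem frobeniusSq_adjoint (X : E →ₗ[ℝ] E) : frobeniusSq X.adjoint = frobeniusSq X := by
  rw [frobeniusSq, frobeniusSq, LinearMap.adjoint_adjoint, LinearMap.trace_comp_comm']

theorem norm_apply_sq_le_frobeniusSq_mul (X : E →ₗ[ℝ] E) (v : E) :
    ‖X v‖ ^ 2 ≤ frobeniusSq X * ‖v‖ ^ 2 := by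
  set b := stdOrthonormalBasis ℝ E
  have hXv : X v = ∑ a, ⟪b a, v⟫ • X (b a) := by
    conv_lhs => rw [← b.sum_repr' v]
    simp
  have hle : ‖X v‖ ≤ ∑ a, ‖X (b a)‖ * ‖⟪b a, v⟫‖ := by
    rw [hXv]
    exact norm_sum_le_of_le _ fun a _ => by rw [norm_smul, mul_comm]
  calc ‖X v‖ ^ 2 ≤ (∑ a, ‖X (b a)‖ * ‖⟪b a, v⟫‖) ^ 2 := by gcongr
    _ ≤ (∑ a, ‖X (b a)‖ ^ 2) * ∑ a, ‖⟪b a, v⟫‖ ^ 2 := Finset.sum_mul_sq_le_sq_mul_sq _ _ _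
    _ = frobeniusSq X * ‖v‖ ^ 2 := by
      rw [b.sum_sq_norm_inner_right, frobeniusSq_eq_sum_norm_sq b]

theorem norm_apply_le_sqrt_frobeniusSq_mul (X : E →ₗ[ℝ] E) (v : E) :
    ‖X v‖ ≤ √(frobeniusSq X) * ‖v‖ := by
  refine le_of_sq_le_sq ?_ (by positivity)
  rw [mul_pow, Real.sq_sqrt (frobeniusSq_nonneg X)]
  exact norm_apply_sq_le_frobeniusSq_mul X v

theorem frobeniusSq_le_of_norm_le {X : E →ₗ[ℝ] E} {e : ℝ} (hX : ∀ v, ‖X v‖ ≤ e * ‖v‖) :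
    frobeniusSq X ≤ finrank ℝ E * e ^ 2 := by
  set b := stdOrthonormalBasis ℝ E
  have hb : ∀ a, ‖X (b a)‖ ^ 2 ≤ e ^ 2 := fun a =>
    pow_le_pow_left₀ (norm_nonneg _) (by simpa using hX (b a)) 2
  calc frobeniusSq X = ∑ a, ‖X (b a)‖ ^ 2 := frobeniusSq_eq_sum_norm_sq b X
    _ ≤ ∑ _a, e ^ 2 := Finset.sum_le_sum fun a _ => hb a
    _ = finrank ℝ E * e ^ 2 := by simp

end Frobenius

/-- The weighted frame operator `∑ i, w x_i x_i^*`. The weight allows the vectors to be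
normalized: a frame of vectors of squared length `w` is `√w` times a frame of unit vectors. -/
noncomputable def frameMap (w : ℝ) (x : κ → E) : E →ₗ[ℝ] E :=
  w • ∑ i, (innerₛₗ ℝ (x i)).smulRight (x i)

theorem inner_frameMap (w : ℝ) (x : κ → E) (u v : E) :
    ⟪u, frameMap w x v⟫ = w * ∑ i, ⟪x i, u⟫ * ⟪x i, v⟫ := by
  simp [frameMap, inner_smul_right, inner_sum, real_inner_comm u, mul_comm]

theorem inner_frameMap_self (w : ℝ) (x : κ → E) (v : E) :
    ⟪v, frameMap w x v⟫ = w * ∑ i, ⟪x i, v⟫ ^ 2 := by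
  simp only [inner_frameMap, sq]

theorem frameMap_isSymmetric (w : ℝ) (x : κ → E) : (frameMap w x).IsSymmetric := fun u v => by
  simp only [real_inner_comm v, inner_frameMap, mul_comm]

theorem frameMap_comp_isSymmetric (w : ℝ) (x : κ → E) {R : E →ₗ[ℝ] E} (hR : R.IsSymmetric) :
    frameMap w (fun i => R (x i)) = R ∘ₗ frameMap w x ∘ₗ R := by
  refine LinearMap.ext fun v => ext_inner_left ℝ fun u => ?_
  rw [LinearMap.comp_apply, LinearMap.comp_apply, ← hR, inner_frameMap, inner_frameMap]
  simp only [hR (x _)]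

theorem trace_comp_frameMap [FiniteDimensional ℝ E] (w : ℝ) (x : κ → E) (X : E →ₗ[ℝ] E) :
    LinearMap.trace ℝ E (X ∘ₗ frameMap w x) = w * ∑ i, ⟪x i, X (x i)⟫ := by
  have hX : X ∘ₗ frameMap w x = w • ∑ i, (innerₛₗ ℝ (x i)).smulRight (X (x i)) := by
    ext v
    simp [frameMap]
  simp [hX, LinearMap.trace_smulRight]

/-- The deviation of the weighted frame operator from the identity. -/
noncomputable def frameError (w : ℝ) (x : κ → E) : E →ₗ[ℝ] E := frameMap w x - LinearMap.id

theorem frameError_isSymmetric (w : ℝ) (x : κ → E) : (frameError w x).IsSymmetric :=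
  (frameMap_isSymmetric w x).sub LinearMap.IsSymmetric.id

theorem inner_frameError_self (w : ℝ) (x : κ → E) (v : E) :
    ⟪v, frameError w x v⟫ = w * ∑ i, ⟪x i, v⟫ ^ 2 - ‖v‖ ^ 2 := by
  simp [frameError, inner_sub_right, inner_frameMap_self]

theorem trace_frameError [FiniteDimensional ℝ E] {w : ℝ} {x : κ → E} (hx : ∀ i, ‖x i‖ = 1)
    (hw : w * Fintype.card κ = finrank ℝ E) : LinearMap.trace ℝ E (frameError w x) = 0 := by
  have h := trace_comp_frameMap w x LinearMap.id
  rw [LinearMap.id_comp] at h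
  simp [frameError, h, hx, hw]

/-- The frame operator of `x`, weighted by `w`, lies between `1 - e` and `1 + e`. -/
def NearParseval (w e : ℝ) (x : κ → E) : Prop :=
  ∀ v, |⟪v, frameError w x v⟫| ≤ e * ‖v‖ ^ 2

theorem nearParseval_iff {w e : ℝ} {x : κ → E} : NearParseval w e x ↔
    ∀ v, (1 - e) * ‖v‖ ^ 2 ≤ w * ∑ i, ⟪x i, v⟫ ^ 2 ∧
      w * ∑ i, ⟪x i, v⟫ ^ 2 ≤ (1 + e) * ‖v‖ ^ 2 := by
  refine forall_congr' fun v => ?_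
  rw [inner_frameError_self, abs_le]
  constructor <;> rintro ⟨h1, h2⟩ <;> constructor <;> linarith

namespace NearParseval

variable {w e : ℝ} {x : κ → E}

theorem norm_frameError_le (hx : NearParseval w e x) (v : E) : ‖frameError w x v‖ ≤ e * ‖v‖ :=
  norm_apply_le_of_abs_inner_self_le (frameError_isSymmetric w x) hx v

variable [FiniteDimensional ℝ E]

theorem frobeniusSq_frameError_le (hx : NearParseval w e x) :
    frobeniusSq (frameError w x) ≤ finrank ℝ E * e ^ 2 :=
  frobeniusSq_le_of_norm_le hx.norm_frameError_le

theorem sum_norm_apply_sq_le (hx : NearParseval w e x) (X : E →ₗ[ℝ] E) :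
    w * ∑ i, ‖X (x i)‖ ^ 2 ≤ (1 + e) * frobeniusSq X := by
  set b := stdOrthonormalBasis ℝ E
  calc w * ∑ i, ‖X (x i)‖ ^ 2
      = ∑ a, w * ∑ i, ⟪x i, X.adjoint (b a)⟫ ^ 2 := by
        simp only [LinearMap.adjoint_inner_right]
        rw [← Finset.mul_sum, Finset.sum_comm]
        simp only [real_inner_comm (b _), b.sum_sq_inner_right]
    _ ≤ ∑ a, (1 + e) * ‖X.adjoint (b a)‖ ^ 2 :=
        Finset.sum_le_sum fun a _ => (nearParseval_iff.1 hx _).2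
    _ = (1 + e) * frobeniusSq X := by
        rw [← Finset.mul_sum, ← frobeniusSq_eq_sum_norm_sq, frobeniusSq_adjoint]

end NearParseval

end FrameOperators

section InverseSquareRoot

open Module
open scoped RealInnerProductSpace

variable {E : Type*} [NormedAddCommGroup E] [InnerProductSpace ℝ E]
variable {ι : Type*} [Fintype ι]

/-- The operator with eigenvalues `f k` at the vectors of the orthonormal basis `b`. -/
noncomputable def diagMap (b : OrthonormalBasis ι ℝ E) (f : ι → ℝ) : E →ₗ[ℝ] E :=
  ∑ k, f k • (innerₛₗ ℝ (b k)).smulRight (b k)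

theorem inner_diagMap (b : OrthonormalBasis ι ℝ E) (f : ι → ℝ) (k : ι) (v : E) :
    ⟪b k, diagMap b f v⟫ = f k * ⟪b k, v⟫ := by
  classical
  simp [diagMap, inner_sum, inner_smul_right, b.inner_eq_ite]

theorem diagMap_isSymmetric (b : OrthonormalBasis ι ℝ E) (f : ι → ℝ) :
    (diagMap b f).IsSymmetric := fun u v => by
  rw [← b.sum_inner_mul_inner, ← b.sum_inner_mul_inner u]
  simp only [real_inner_comm (b _), inner_diagMap]
  exact Finset.sum_congr rfl fun k _ => by ring

theorem diagMap_comp (b : OrthonormalBasis ι ℝ E) (f g : ι → ℝ) :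
    diagMap b f ∘ₗ diagMap b g = diagMap b (f * g) := by
  refine LinearMap.ext fun v => InnerProductSpace.ext_inner_left_basis b.toBasis fun k => ?_
  simp [inner_diagMap, mul_assoc]

theorem diagMap_one (b : OrthonormalBasis ι ℝ E) : diagMap b 1 = LinearMap.id := by
  refine LinearMap.ext fun v => InnerProductSpace.ext_inner_left_basis b.toBasis fun k => ?_
  simp [inner_diagMap]

theorem norm_diagMap_sub_self_le (b : OrthonormalBasis ι ℝ E) {f g : ι → ℝ} {c : ℝ} (hc : 0 ≤ c)
    (hfg : ∀ k, |f k - 1| ≤ c * |g k - 1|) (v : E) :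
    ‖diagMap b f v - v‖ ≤ c * ‖diagMap b g v - v‖ := by
  refine le_of_sq_le_sq ?_ (by positivity)
  rw [mul_pow, ← b.sum_sq_inner_right, ← b.sum_sq_inner_right, Finset.mul_sum]
  refine Finset.sum_le_sum fun k _ => ?_
  rw [inner_sub_right, inner_sub_right, inner_diagMap, inner_diagMap, ← sub_one_mul,
    ← sub_one_mul, mul_pow, mul_pow, ← mul_assoc, ← sq_abs (f k - 1), ← sq_abs (g k - 1),
    ← mul_pow c]
  exact mul_le_mul_of_nonneg_right (pow_le_pow_left₀ (abs_nonneg _) (hfg k) 2) (sq_nonneg _)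

variable [FiniteDimensional ℝ E] {S : E →ₗ[ℝ] E}

theorem diagMap_eigenvectorBasis (hS : S.IsSymmetric) :
    diagMap (hS.eigenvectorBasis rfl) (hS.eigenvalues rfl) = S := by
  refine LinearMap.ext fun v => InnerProductSpace.ext_inner_left_basis
    (hS.eigenvectorBasis rfl).toBasis fun k => ?_
  rw [OrthonormalBasis.coe_toBasis, inner_diagMap, ← hS, hS.apply_eigenvectorBasis]
  simp [inner_smul_left]

theorem le_eigenvalues_of_le_inner (hS : S.IsSymmetric) {c : ℝ}
    (h : ∀ v, c * ‖v‖ ^ 2 ≤ ⟪v, S v⟫) (k : Fin (finrank ℝ E)) : c ≤ hS.eigenvalues rfl k := by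
  have hk := h (hS.eigenvectorBasis rfl k)
  rw [hS.apply_eigenvectorBasis, inner_smul_right, real_inner_self_eq_norm_sq] at hk
  simpa using hk

/-- The inverse square root of a symmetric operator, meant for a positive definite one: the
eigenvalues `l ≤ 0` are sent to `0`. -/
noncomputable def invSqrt (hS : S.IsSymmetric) : E →ₗ[ℝ] E :=
  diagMap (hS.eigenvectorBasis rfl) fun k => (√(hS.eigenvalues rfl k))⁻¹

theorem invSqrt_isSymmetric (hS : S.IsSymmetric) : (invSqrt hS).IsSymmetric :=
  diagMap_isSymmetric _ _

theorem invSqrt_comp_comp_invSqrt (hS : S.IsSymmetric) {c : ℝ} (hc : 0 < c)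
    (h : ∀ v, c * ‖v‖ ^ 2 ≤ ⟪v, S v⟫) : invSqrt hS ∘ₗ S ∘ₗ invSqrt hS = LinearMap.id := by
  nth_rw 2 [← diagMap_eigenvectorBasis hS]
  rw [invSqrt, diagMap_comp, diagMap_comp, ← diagMap_one (hS.eigenvectorBasis rfl)]
  congr 1
  funext k
  have hk : 0 < hS.eigenvalues rfl k := hc.trans_le (le_eigenvalues_of_le_inner hS h k)
  have := Real.sqrt_pos.2 hk
  simp only [Pi.mul_apply, Pi.one_apply]
  field_simp
  rw [Real.sq_sqrt hk.le]

theorem abs_inv_sqrt_sub_one_le {a l : ℝ} (ha : 0 < a) (hl : a ^ 2 ≤ l) :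
    |(√l)⁻¹ - 1| ≤ (a * (1 + a))⁻¹ * |l - 1| := by
  have hs : a ≤ √l := Real.le_sqrt_of_sq_le hl
  have hs0 : 0 < √l := ha.trans_le hs
  have hfactor : (√l)⁻¹ - 1 = (√l * (1 + √l))⁻¹ * (1 - l) := by
    field_simp
    nlinarith [Real.sq_sqrt ((sq_nonneg a).trans hl)]
  rw [hfactor, abs_mul, abs_of_pos (by positivity : 0 < (√l * (1 + √l))⁻¹), abs_sub_comm 1 l]
  gcongr

theorem norm_invSqrt_sub_self_le (hS : S.IsSymmetric) {a : ℝ} (ha : 0 < a)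
    (h : ∀ v, a ^ 2 * ‖v‖ ^ 2 ≤ ⟪v, S v⟫) (v : E) :
    ‖invSqrt hS v - v‖ ≤ (a * (1 + a))⁻¹ * ‖S v - v‖ := by
  conv_rhs => rw [← diagMap_eigenvectorBasis hS]
  exact norm_diagMap_sub_self_le _ (by positivity)
    (fun k => abs_inv_sqrt_sub_one_le ha (le_eigenvalues_of_le_inner hS h k)) v

end InverseSquareRoot

section Scaling

open Module NormedSpace
open scoped RealInnerProductSpace

variable {E : Type*} [NormedAddCommGroup E] [InnerProductSpace ℝ E]
variable {κ : Type*} [Fintype κ] {w e g : ℝ} {x y z : κ → E}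

theorem weighted_sum_add_sq_le (hw : 0 ≤ w) {A B : ℝ} (hA : 0 ≤ A) (hB : 0 ≤ B) {p q : κ → ℝ}
    (hp : w * ∑ i, p i ^ 2 ≤ A ^ 2) (hq : w * ∑ i, q i ^ 2 ≤ B ^ 2) :
    w * ∑ i, (p i + q i) ^ 2 ≤ (A + B) ^ 2 := by
  have hpq : w * ∑ i, p i * q i ≤ A * B := by
    refine le_of_sq_le_sq ?_ (by positivity)
    calc (w * ∑ i, p i * q i) ^ 2 = w ^ 2 * (∑ i, p i * q i) ^ 2 := by ring
      _ ≤ w ^ 2 * ((∑ i, p i ^ 2) * ∑ i, q i ^ 2) := by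
        gcongr
        exact Finset.sum_mul_sq_le_sq_mul_sq _ _ _
      _ = (w * ∑ i, p i ^ 2) * (w * ∑ i, q i ^ 2) := by ring
      _ ≤ A ^ 2 * B ^ 2 := by gcongr
      _ = (A * B) ^ 2 := by ring
  have hexpand : w * ∑ i, (p i + q i) ^ 2 =
      w * ∑ i, p i ^ 2 + 2 * (w * ∑ i, p i * q i) + w * ∑ i, q i ^ 2 := by
    simp only [Finset.mul_sum, ← Finset.sum_add_distrib]
    exact Finset.sum_congr rfl fun i _ => by ring
  linarith

theorem inner_apply_sub_inner_apply_sq_le {X : E →ₗ[ℝ] E} (hX : X.IsSymmetric) {u v : E} {δ : ℝ}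
    (h : ‖v - u‖ ≤ δ) :
    (⟪v, X v⟫ - ⟪u, X u⟫) ^ 2 ≤ 2 * δ ^ 2 * (‖X u‖ ^ 2 + ‖X v‖ ^ 2) := by
  have hdiff : ⟪v, X v⟫ - ⟪u, X u⟫ = ⟪v - u, X u + X v⟫ := by
    have : ⟪v, X u⟫ = ⟪u, X v⟫ := by rw [← hX, real_inner_comm]
    simp only [inner_sub_left, inner_add_right]
    linarith
  have hsq : ⟪v - u, X u + X v⟫ ^ 2 ≤ (δ * (‖X u‖ + ‖X v‖)) ^ 2 := by
    refine sq_le_sq' (neg_le_of_abs_le ?_) (le_of_abs_le ?_) <;>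
    exact (abs_real_inner_le_norm _ _).trans
      (mul_le_mul h (norm_add_le _ _) (norm_nonneg _) ((norm_nonneg _).trans h))
  rw [hdiff]
  nlinarith [mul_nonneg (sq_nonneg δ) (sq_nonneg (‖X u‖ - ‖X v‖))]

theorem norm_normalize_sub_le {u v : E} (hu : ‖u‖ = 1) (hv : v ≠ 0) :
    ‖normalize v - u‖ ≤ 2 * ‖v - u‖ := by
  have hnv : ‖normalize v - v‖ ≤ ‖v - u‖ := by
    have : normalize v - v = (1 - ‖v‖) • normalize v := by
      rw [sub_smul, one_smul, norm_smul_normalize]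
    rw [this, norm_smul, norm_normalize hv, mul_one, Real.norm_eq_abs, abs_sub_comm, ← hu]
    exact abs_norm_sub_norm_le _ _
  linarith [norm_sub_le_norm_sub_add_norm_sub (normalize v) v u]

theorem sum_inner_sq_of_frameMap_eq_id (hz : frameMap w z = LinearMap.id) (v : E) :
    w * ∑ i, ⟪z i, v⟫ ^ 2 = ‖v‖ ^ 2 := by
  rw [← inner_frameMap_self, hz, LinearMap.id_apply, real_inner_self_eq_norm_sq]

theorem nearParseval_normalize (hw : 0 ≤ w) (hz : frameMap w z = LinearMap.id)
    (hz1 : ∀ i, (1 - e) * ‖z i‖ ^ 2 ≤ 1) (hz2 : ∀ i, 1 ≤ (1 + e) * ‖z i‖ ^ 2) :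
    NearParseval w e fun i => normalize (z i) := by
  refine nearParseval_iff.2 fun v => ?_
  have hterm : ∀ i, ‖z i‖ ^ 2 * ⟪normalize (z i), v⟫ ^ 2 = ⟪z i, v⟫ ^ 2 := fun i => by
    conv_rhs => rw [← norm_smul_normalize (z i)]
    rw [inner_smul_left, conj_trivial, mul_pow]
  rw [← sum_inner_sq_of_frameMap_eq_id hz, mul_left_comm, mul_left_comm (1 + e),
    Finset.mul_sum _ _ (1 - e), Finset.mul_sum _ _ (1 + e)]
  constructor <;> refine mul_le_mul_of_nonneg_left (Finset.sum_le_sum fun i _ => ?_) hw <;>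
    rw [← hterm, ← mul_assoc]
  · exact mul_le_of_le_one_left (sq_nonneg _) (hz1 i)
  · exact le_mul_of_one_le_left (sq_nonneg _) (hz2 i)

theorem NearParseval.sq_mul_norm_sq_le_inner_frameMap (he : e ≤ 1 / 100)
    (hx : NearParseval w e x) (v : E) :
    (99 / 100) ^ 2 * ‖v‖ ^ 2 ≤ ⟪v, frameMap w x v⟫ := by
  rw [inner_frameMap_self]
  refine le_trans ?_ (nearParseval_iff.1 hx v).1
  gcongr
  linarith

variable [FiniteDimensional ℝ E]

/-- The spectral gap of the frame `x`: on traceless symmetric operators, the quadratic map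
`X ↦ (⟪x i, X (x i)⟫)_i` has norm at most `g`, for the Frobenius norm and the `w`-weighted
Euclidean norm. -/
def QuadBound (w g : ℝ) (x : κ → E) : Prop :=
  ∀ X : E →ₗ[ℝ] E, X.IsSymmetric → LinearMap.trace ℝ E X = 0 →
    w * ∑ i, ⟪x i, X (x i)⟫ ^ 2 ≤ g ^ 2 * frobeniusSq X

theorem QuadBound.of_norm_sub_le (hw : 0 ≤ w) (he : e ≤ 1) (hg : 0 ≤ g) {δ : ℝ} (hδ : 0 ≤ δ)
    (hx : NearParseval w e x) (hy : NearParseval w e y) (hxy : ∀ i, ‖y i - x i‖ ≤ δ)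
    (hQ : QuadBound w g x) : QuadBound w (g + 3 * δ) y := by
  intro X hX htr
  have hF := frobeniusSq_nonneg X
  have hp : w * ∑ i, ⟪x i, X (x i)⟫ ^ 2 ≤ (g * √(frobeniusSq X)) ^ 2 := by
    rw [mul_pow, Real.sq_sqrt hF]
    exact hQ X hX htr
  have hq : w * ∑ i, (⟪y i, X (y i)⟫ - ⟪x i, X (x i)⟫) ^ 2 ≤ (3 * δ * √(frobeniusSq X)) ^ 2 := by
    rw [mul_pow, Real.sq_sqrt hF]
    calc w * ∑ i, (⟪y i, X (y i)⟫ - ⟪x i, X (x i)⟫) ^ 2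
        ≤ w * ∑ i, 2 * δ ^ 2 * (‖X (x i)‖ ^ 2 + ‖X (y i)‖ ^ 2) := by
          gcongr with i
          exact inner_apply_sub_inner_apply_sq_le hX (hxy i)
      _ = 2 * δ ^ 2 * (w * ∑ i, ‖X (x i)‖ ^ 2 + w * ∑ i, ‖X (y i)‖ ^ 2) := by
          rw [← Finset.mul_sum, Finset.sum_add_distrib]
          ring
      _ ≤ 2 * δ ^ 2 * ((1 + e) * frobeniusSq X + (1 + e) * frobeniusSq X) :=
          mul_le_mul_of_nonneg_left
            (add_le_add (hx.sum_norm_apply_sq_le X) (hy.sum_norm_apply_sq_le X)) (by positivity)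
      _ ≤ (3 * δ) ^ 2 * frobeniusSq X := by
          nlinarith [mul_nonneg (sq_nonneg δ) (mul_nonneg (sub_nonneg.2 he) hF),
            mul_nonneg (sq_nonneg δ) hF]
  have h := weighted_sum_add_sq_le hw (by positivity) (by positivity) hp hq
  simp only [add_sub_cancel] at h
  rwa [← add_mul, mul_pow, Real.sq_sqrt hF] at h

theorem frobeniusSq_frameError (hy : ∀ i, ‖y i‖ = 1) (hc : w * Fintype.card κ = finrank ℝ E) :
    frobeniusSq (frameError w y) = w * ∑ i, ⟪y i, frameError w y (y i)⟫ := by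
  have hcomp : frameError w y ∘ₗ frameError w y =
      frameError w y ∘ₗ frameMap w y - frameError w y := by
    conv_lhs => enter [2]; rw [frameError]
    rw [LinearMap.comp_sub, LinearMap.comp_id]
  rw [frobeniusSq, (frameError_isSymmetric w y).adjoint_eq, hcomp, map_sub, trace_comp_frameMap,
    trace_frameError hy hc, sub_zero]

/-- Testing the Parseval identity of `z` against the traceless `frameError` of its normalization
allows us to insert the factors `1 - ‖z i‖ ^ 2`, to which Cauchy-Schwarz applies. -/
theorem QuadBound.frobeniusSq_frameError_normalize_le (hw : 0 ≤ w)
    (hc : w * Fintype.card κ = finrank ℝ E) (hz : frameMap w z = LinearMap.id)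
    (hz0 : ∀ i, z i ≠ 0) (hQ : QuadBound w g fun i => normalize (z i)) :
    frobeniusSq (frameError w fun i => normalize (z i)) ≤
      g ^ 2 * (w * ∑ i, (1 - ‖z i‖ ^ 2) ^ 2) := by
  set y : κ → E := fun i => normalize (z i)
  have hy : ∀ i, ‖y i‖ = 1 := fun i => norm_normalize (hz0 i)
  set D := frameError w y
  have htr : LinearMap.trace ℝ E D = 0 := trace_frameError hy hc
  have horth : w * ∑ i, ‖z i‖ ^ 2 * ⟪y i, D (y i)⟫ = 0 := by
    rw [← htr, ← congrArg (LinearMap.trace ℝ E) (LinearMap.comp_id D), ← hz, trace_comp_frameMap]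
    refine congrArg _ (Finset.sum_congr rfl fun i _ => ?_)
    conv_rhs => rw [← norm_smul_normalize (z i)]
    rw [map_smul, inner_smul_left, inner_smul_right, conj_trivial, ← mul_assoc, sq]
  have hF : frobeniusSq D = w * ∑ i, ⟪y i, D (y i)⟫ * (1 - ‖z i‖ ^ 2) := by
    rw [frobeniusSq_frameError hy hc, ← sub_zero (w * _), ← horth, ← mul_sub,
      ← Finset.sum_sub_distrib]
    exact congrArg _ (Finset.sum_congr rfl fun i _ => by ring)
  set B := w * ∑ i, (1 - ‖z i‖ ^ 2) ^ 2 with hB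
  have hB0 : 0 ≤ B := by positivity
  have hCS : frobeniusSq D * frobeniusSq D ≤ g ^ 2 * B * frobeniusSq D := by
    calc frobeniusSq D * frobeniusSq D
        = w ^ 2 * (∑ i, ⟪y i, D (y i)⟫ * (1 - ‖z i‖ ^ 2)) ^ 2 := by rw [hF]; ring
      _ ≤ w ^ 2 * ((∑ i, ⟪y i, D (y i)⟫ ^ 2) * ∑ i, (1 - ‖z i‖ ^ 2) ^ 2) := by
          gcongr
          exact Finset.sum_mul_sq_le_sq_mul_sq _ _ _
      _ = (w * ∑ i, ⟪y i, D (y i)⟫ ^ 2) * B := by rw [hB]; ring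
      _ ≤ g ^ 2 * frobeniusSq D * B :=
          mul_le_mul_of_nonneg_right (hQ D (frameError_isSymmetric w y) htr) hB0
      _ = g ^ 2 * B * frobeniusSq D := by ring
  rcases (frobeniusSq_nonneg D).eq_or_lt with h | h
  · rw [← h]
    positivity
  · exact le_of_mul_le_mul_right hCS h

/-- One step of the scaling iteration: make the frame Parseval by applying the inverse square
root of its frame operator, then normalize its vectors. -/
noncomputable def scalingStep (w : ℝ) (x : κ → E) : κ → E :=
  fun i => normalize (invSqrt (frameMap_isSymmetric w x) (x i))

section ScalingStep

variable (he : e ≤ 1 / 100) (hn : ∀ i, ‖x i‖ = 1) (hx : NearParseval w e x)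
include he hx

theorem NearParseval.invSqrt_comp_frameMap_comp_invSqrt :
    invSqrt (frameMap_isSymmetric w x) ∘ₗ frameMap w x ∘ₗ invSqrt (frameMap_isSymmetric w x) =
      LinearMap.id :=
  invSqrt_comp_comp_invSqrt _ (by norm_num) (hx.sq_mul_norm_sq_le_inner_frameMap he)

theorem NearParseval.frameMap_invSqrt :
    frameMap w (fun i => invSqrt (frameMap_isSymmetric w x) (x i)) = LinearMap.id := by
  rw [frameMap_comp_isSymmetric _ _ (invSqrt_isSymmetric _),
    hx.invSqrt_comp_frameMap_comp_invSqrt he]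

theorem NearParseval.norm_invSqrt_sub_le (v : E) :
    ‖invSqrt (frameMap_isSymmetric w x) v - v‖ ≤ 51 / 100 * ‖frameError w x v‖ := by
  refine (norm_invSqrt_sub_self_le _ (by norm_num : (0 : ℝ) < 99 / 100)
    (hx.sq_mul_norm_sq_le_inner_frameMap he) v).trans ?_
  rw [frameError, LinearMap.sub_apply, LinearMap.id_apply]
  gcongr
  norm_num

include hn

theorem NearParseval.norm_sq_invSqrt_bounds (i : κ) :
    (1 - e) * ‖invSqrt (frameMap_isSymmetric w x) (x i)‖ ^ 2 ≤ 1 ∧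
      1 ≤ (1 + e) * ‖invSqrt (frameMap_isSymmetric w x) (x i)‖ ^ 2 := by
  have hone : w * ∑ j, ⟪x j, invSqrt (frameMap_isSymmetric w x) (x i)⟫ ^ 2 = 1 := by
    have hinv := LinearMap.congr_fun (hx.invSqrt_comp_frameMap_comp_invSqrt he) (x i)
    rw [LinearMap.comp_apply, LinearMap.comp_apply, LinearMap.id_apply] at hinv
    rw [← inner_frameMap_self, invSqrt_isSymmetric, hinv, real_inner_self_eq_norm_sq, hn, one_pow]
  simpa only [hone] using nearParseval_iff.1 hx (invSqrt (frameMap_isSymmetric w x) (x i))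

theorem NearParseval.invSqrt_ne_zero (i : κ) : invSqrt (frameMap_isSymmetric w x) (x i) ≠ 0 := by
  intro h
  have := (hx.norm_sq_invSqrt_bounds he hn i).2
  rw [h, norm_zero] at this
  norm_num at this

theorem NearParseval.norm_scalingStep (i : κ) : ‖scalingStep w x i‖ = 1 :=
  norm_normalize (hx.invSqrt_ne_zero he hn i)

theorem NearParseval.nearParseval_scalingStep (hw : 0 ≤ w) : NearParseval w e (scalingStep w x) :=
  nearParseval_normalize hw (hx.frameMap_invSqrt he)
    (fun i => (hx.norm_sq_invSqrt_bounds he hn i).1)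
    fun i => (hx.norm_sq_invSqrt_bounds he hn i).2

theorem NearParseval.norm_scalingStep_sub_le (i : κ) :
    ‖scalingStep w x i - x i‖ ≤ 11 / 10 * ‖frameError w x (x i)‖ := by
  have h1 := norm_normalize_sub_le (hn i) (hx.invSqrt_ne_zero he hn i)
  have h2 := hx.norm_invSqrt_sub_le he (x i)
  have h3 := norm_nonneg (frameError w x (x i))
  exact h1.trans (by linarith)

theorem NearParseval.one_sub_norm_sq_sq_le (i : κ) :
    (1 - ‖invSqrt (frameMap_isSymmetric w x) (x i)‖ ^ 2) ^ 2 ≤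
      11 / 10 * ‖frameError w x (x i)‖ ^ 2 := by
  set z := invSqrt (frameMap_isSymmetric w x) (x i)
  have hz : ‖z‖ ≤ 101 / 100 := by
    have := (hx.norm_sq_invSqrt_bounds he hn i).1
    by_contra! h
    nlinarith [sq_nonneg ‖z‖]
  have hdiff : |1 - ‖z‖| ≤ 51 / 100 * ‖frameError w x (x i)‖ := by
    rw [← hn i, abs_sub_comm]
    exact (abs_norm_sub_norm_le _ _).trans (hx.norm_invSqrt_sub_le he (x i))
  calc (1 - ‖z‖ ^ 2) ^ 2 = |1 - ‖z‖| ^ 2 * (1 + ‖z‖) ^ 2 := by rw [sq_abs]; ring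
    _ ≤ (51 / 100 * ‖frameError w x (x i)‖) ^ 2 * (1 + 101 / 100) ^ 2 := by gcongr
    _ ≤ 11 / 10 * ‖frameError w x (x i)‖ ^ 2 := by nlinarith [sq_nonneg ‖frameError w x (x i)‖]

theorem NearParseval.frobeniusSq_frameError_scalingStep_le (hw : 0 ≤ w)
    (hc : w * Fintype.card κ = finrank ℝ E) (hQ : QuadBound w (39 / 50) (scalingStep w x)) :
    frobeniusSq (frameError w (scalingStep w x)) ≤
      (9 / 10) ^ 2 * frobeniusSq (frameError w x) := by
  have hF := frobeniusSq_nonneg (frameError w x)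
  calc frobeniusSq (frameError w (scalingStep w x))
      ≤ (39 / 50) ^ 2 *
          (w * ∑ i, (1 - ‖invSqrt (frameMap_isSymmetric w x) (x i)‖ ^ 2) ^ 2) :=
        hQ.frobeniusSq_frameError_normalize_le hw hc (hx.frameMap_invSqrt he)
          (hx.invSqrt_ne_zero he hn)
    _ ≤ (39 / 50) ^ 2 * (w * ∑ i, 11 / 10 * ‖frameError w x (x i)‖ ^ 2) := by
        gcongr with i
        exact hx.one_sub_norm_sq_sq_le he hn i
    _ = (39 / 50) ^ 2 * (11 / 10) * (w * ∑ i, ‖frameError w x (x i)‖ ^ 2) := by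
        rw [← Finset.mul_sum]
        ring
    _ ≤ (39 / 50) ^ 2 * (11 / 10) * ((1 + 1 / 100) * frobeniusSq (frameError w x)) := by
        refine mul_le_mul_of_nonneg_left ((hx.sum_norm_apply_sq_le _).trans ?_) (by norm_num)
        gcongr
    _ ≤ (9 / 10) ^ 2 * frobeniusSq (frameError w x) := by linarith

end ScalingStep

end Scaling

section ScalingLimit

open Module Filter Topology
open scoped RealInnerProductSpace

theorem exists_tendsto_of_geometric {E κ : Type*} [NormedAddCommGroup E] [CompleteSpace E]
    [Fintype κ] {y : ℕ → κ → E} {C r : ℝ} (hC : 0 ≤ C) (hr0 : 0 ≤ r)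
    (hr : r < 1) (hy : ∀ k, ∑ i, ‖y (k + 1) i - y k i‖ ^ 2 ≤ (C * r ^ k) ^ 2) :
    ∃ z : κ → E, (∀ i, Tendsto (fun k => y k i) atTop (𝓝 (z i))) ∧
      ∑ i, ‖y 0 i - z i‖ ^ 2 ≤ (C / (1 - r)) ^ 2 := by
  set p : ℕ → PiLp 2 (fun _ : κ => E) := fun k => WithLp.toLp 2 (y k)
  have hdist : ∀ k, dist (p k) (p (k + 1)) ≤ C * r ^ k := fun k => by
    refine le_of_sq_le_sq ?_ (by positivity)
    rw [dist_comm, dist_eq_norm, PiLp.norm_sq_eq_of_L2]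
    exact hy k
  obtain ⟨z, hz⟩ := cauchySeq_tendsto_of_complete (cauchySeq_of_le_geometric r C hr hdist)
  refine ⟨z, fun i => ((PiLp.continuous_apply 2 (fun _ : κ => E) i).tendsto z).comp hz, ?_⟩
  have h0 := pow_le_pow_left₀ dist_nonneg
    (dist_le_of_le_geometric_of_tendsto₀ r C hr hdist hz) 2
  rwa [dist_eq_norm, PiLp.norm_sq_eq_of_L2] at h0

variable {E : Type*} [NormedAddCommGroup E] [InnerProductSpace ℝ E]
variable {κ : Type*} [Fintype κ] {w e : ℝ} {x : κ → E}

theorem tendsto_frameMap_apply {y : ℕ → κ → E} {z : κ → E}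
    (hy : ∀ i, Tendsto (fun k => y k i) atTop (𝓝 (z i))) (v : E) :
    Tendsto (fun k => frameMap w (y k) v) atTop (𝓝 (frameMap w z v)) := by
  simp only [frameMap, LinearMap.smul_apply, LinearMap.sum_apply, LinearMap.smulRight_apply,
    innerₛₗ_apply_apply]
  exact (tendsto_finsetSum _ fun i _ => ((hy i).inner tendsto_const_nhds).smul (hy i)).const_smul w

variable [FiniteDimensional ℝ E]

theorem frameMap_eq_id_of_tendsto {y : ℕ → κ → E} {z : κ → E}
    (hy : ∀ i, Tendsto (fun k => y k i) atTop (𝓝 (z i)))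
    (hF : Tendsto (fun k => frobeniusSq (frameError w (y k))) atTop (𝓝 0)) :
    frameMap w z = LinearMap.id := by
  refine LinearMap.ext fun v => tendsto_nhds_unique (tendsto_frameMap_apply hy v) ?_
  rw [LinearMap.id_apply, tendsto_iff_norm_sub_tendsto_zero]
  have hroot : Tendsto (fun k => √(frobeniusSq (frameError w (y k))) * ‖v‖) atTop (𝓝 0) := by
    simpa using hF.sqrt.mul_const ‖v‖
  exact squeeze_zero (fun _ => norm_nonneg _)
    (fun k => norm_apply_le_sqrt_frobeniusSq_mul (frameError w (y k)) v) hroot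

/-- The sixth power combines the operator norm bound `‖frameError w x (x i)‖ ≤ e` with the
Frobenius bound on `‖frameError w x (x i)‖ ^ 2`, which gains a factor `q ^ 6` but loses the
dimension. -/
theorem NearParseval.norm_frameError_self_le (hx : NearParseval w e x) (hn : ∀ i, ‖x i‖ = 1)
    {δ q : ℝ} (hδ : 0 ≤ δ) (hq : 0 ≤ q) (hed : e ^ 6 * finrank ℝ E ≤ δ ^ 6)
    (hF : frobeniusSq (frameError w x) ≤ q ^ 6 * (finrank ℝ E * e ^ 2)) (i : κ) :
    ‖frameError w x (x i)‖ ≤ δ * q := by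
  set h := ‖frameError w x (x i)‖
  have hop : h ≤ e := by simpa [hn] using hx.norm_frameError_le (x i)
  have hfrob : h ^ 2 ≤ q ^ 6 * (finrank ℝ E * e ^ 2) := by
    simpa [hn] using (norm_apply_sq_le_frobeniusSq_mul (frameError w x) (x i)).trans
      (mul_le_mul_of_nonneg_right hF (sq_nonneg _))
  refine (pow_le_pow_iff_left₀ (norm_nonneg _) (by positivity) (by norm_num : 6 ≠ 0)).1 ?_
  calc h ^ 6 = h ^ 4 * h ^ 2 := by ring
    _ ≤ e ^ 4 * (q ^ 6 * (finrank ℝ E * e ^ 2)) := by gcongr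
    _ = q ^ 6 * (e ^ 6 * finrank ℝ E) := by ring
    _ ≤ q ^ 6 * δ ^ 6 := by gcongr
    _ = (δ * q) ^ 6 := by ring

theorem geom_sum_le_of_lt_one {r : ℝ} (hr0 : 0 ≤ r) (hr : r < 1) (k : ℕ) :
    ∑ j ∈ Finset.range k, r ^ j ≤ (1 - r)⁻¹ := by
  rw [← tsum_geometric_of_lt_one hr0 hr]
  exact (summable_geometric_of_lt_one hr0 hr).sum_le_tsum _ fun j _ => by positivity

section Iterates

variable (hw : 0 ≤ w) (he : e ≤ 1 / 100) (hn : ∀ i, ‖x i‖ = 1) (hx : NearParseval w e x)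
include hw he hn hx

theorem NearParseval.iterate_scalingStep (k : ℕ) :
    (∀ i, ‖(scalingStep w)^[k] x i‖ = 1) ∧ NearParseval w e ((scalingStep w)^[k] x) := by
  induction k with
  | zero => exact ⟨hn, hx⟩
  | succ k ih =>
    rw [Function.iterate_succ_apply']
    exact ⟨ih.2.norm_scalingStep he ih.1, ih.2.nearParseval_scalingStep he ih.1 hw⟩

variable (hed : e ^ 6 * finrank ℝ E ≤ (1 / 4000) ^ 6)
include hed

theorem NearParseval.norm_iterate_scalingStep_succ_sub_le {k : ℕ}
    (hF : frobeniusSq (frameError w ((scalingStep w)^[k] x)) ≤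
      ((9 / 10) ^ k) ^ 2 * frobeniusSq (frameError w x)) (i : κ) :
    ‖(scalingStep w)^[k + 1] x i - (scalingStep w)^[k] x i‖ ≤ 1 / 3000 * (29 / 30) ^ k := by
  obtain ⟨hnk, hxk⟩ := hx.iterate_scalingStep hw he hn k
  have hrate : ((9 / 10 : ℝ) ^ k) ^ 2 ≤ ((29 / 30) ^ k) ^ 6 := by
    rw [pow_right_comm, pow_right_comm (29 / 30 : ℝ)]
    exact pow_le_pow_left₀ (by norm_num) (by norm_num) k
  have hDk := hxk.norm_frameError_self_le hnk (by norm_num) (by positivity) hed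
    (hF.trans (mul_le_mul hrate hx.frobeniusSq_frameError_le (frobeniusSq_nonneg _)
      (by positivity))) i
  rw [Function.iterate_succ_apply']
  have hpos : (0 : ℝ) ≤ (29 / 30) ^ k := by positivity
  exact (hxk.norm_scalingStep_sub_le he hnk i).trans (by linarith)

variable (hc : w * Fintype.card κ = finrank ℝ E) (hQ : QuadBound w (3 / 4) x)
include hc hQ

theorem NearParseval.frobeniusSq_frameError_iterate_le (k : ℕ) :
    frobeniusSq (frameError w ((scalingStep w)^[k] x)) ≤
      ((9 / 10) ^ k) ^ 2 * frobeniusSq (frameError w x) := by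
  induction k using Nat.strong_induction_on with
  | _ k ih =>
  rcases k with - | k
  · simp
  have hclose : ∀ i, ‖(scalingStep w)^[k + 1] x i - x i‖ ≤ 1 / 100 := fun i => by
    have hsum := dist_le_range_sum_of_dist_le (f := fun j => (scalingStep w)^[j] x i) (k + 1)
      (d := fun j => 1 / 3000 * (29 / 30) ^ j) fun {j} hj => by
        rw [dist_comm, dist_eq_norm]
        exact hx.norm_iterate_scalingStep_succ_sub_le hw he hn hed (ih j hj) i
    rw [dist_comm, dist_eq_norm, ← Finset.mul_sum] at hsum
    have hgeom := geom_sum_le_of_lt_one (r := 29 / 30) (by norm_num) (by norm_num) (k + 1)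
    refine hsum.trans ?_
    norm_num at hgeom ⊢
    linarith
  have hQk := hQ.of_norm_sub_le hw (by linarith) (by norm_num) (by norm_num) hx
    (hx.iterate_scalingStep hw he hn (k + 1)).2 hclose
  obtain ⟨hnk, hxk⟩ := hx.iterate_scalingStep hw he hn k
  rw [Function.iterate_succ_apply'] at hQk ⊢
  calc frobeniusSq (frameError w (scalingStep w ((scalingStep w)^[k] x)))
      ≤ (9 / 10) ^ 2 * frobeniusSq (frameError w ((scalingStep w)^[k] x)) :=
        hxk.frobeniusSq_frameError_scalingStep_le he hnk hw hc (by norm_num at hQk ⊢; exact hQk)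
    _ ≤ (9 / 10) ^ 2 * (((9 / 10) ^ k) ^ 2 * frobeniusSq (frameError w x)) := by
        gcongr
        exact ih k k.lt_succ_self
    _ = ((9 / 10) ^ (k + 1)) ^ 2 * frobeniusSq (frameError w x) := by ring

theorem NearParseval.sum_norm_iterate_succ_sub_sq_le (k : ℕ) :
    w * ∑ i, ‖(scalingStep w)^[k + 1] x i - (scalingStep w)^[k] x i‖ ^ 2 ≤
      5 / 4 * (((9 / 10) ^ k) ^ 2 * frobeniusSq (frameError w x)) := by
  obtain ⟨hnk, hxk⟩ := hx.iterate_scalingStep hw he hn k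
  have hdecay := hx.frobeniusSq_frameError_iterate_le hw he hn hed hc hQ k
  rw [Function.iterate_succ_apply']
  set y := (scalingStep w)^[k] x
  calc w * ∑ i, ‖scalingStep w y i - y i‖ ^ 2
      ≤ w * ∑ i, (11 / 10 * ‖frameError w y (y i)‖) ^ 2 := by
        gcongr with i
        exact hxk.norm_scalingStep_sub_le he hnk i
    _ = 121 / 100 * (w * ∑ i, ‖frameError w y (y i)‖ ^ 2) := by
        simp only [mul_pow, ← Finset.mul_sum]
        ring
    _ ≤ 121 / 100 * ((1 + e) * frobeniusSq (frameError w y)) :=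
        mul_le_mul_of_nonneg_left (hxk.sum_norm_apply_sq_le _) (by norm_num)
    _ ≤ 5 / 4 * frobeniusSq (frameError w y) := by nlinarith [frobeniusSq_nonneg (frameError w y)]
    _ ≤ 5 / 4 * (((9 / 10) ^ k) ^ 2 * frobeniusSq (frameError w x)) := by gcongr

end Iterates

theorem NearParseval.exists_frameMap_eq_id (hw : 0 < w) (he : e ≤ 1 / 100) (hn : ∀ i, ‖x i‖ = 1)
    (hx : NearParseval w e x) (hed : e ^ 6 * finrank ℝ E ≤ (1 / 4000) ^ 6)
    (hc : w * Fintype.card κ = finrank ℝ E) (hQ : QuadBound w (3 / 4) x) :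
    ∃ z : κ → E, (∀ i, ‖z i‖ = 1) ∧ frameMap w z = LinearMap.id ∧
      w * ∑ i, ‖x i - z i‖ ^ 2 ≤ 125 * frobeniusSq (frameError w x) := by
  set F := frobeniusSq (frameError w x)
  have hF0 : 0 ≤ F := frobeniusSq_nonneg _
  have hC : √(5 / 4 * F / w) ^ 2 = 5 / 4 * F / w := Real.sq_sqrt (by positivity)
  obtain ⟨z, hz, hxz⟩ := exists_tendsto_of_geometric (y := fun k => (scalingStep w)^[k] x)
    (Real.sqrt_nonneg (5 / 4 * F / w)) (by norm_num : (0 : ℝ) ≤ 9 / 10) (by norm_num) fun k => by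
      rw [mul_pow, hC, div_mul_eq_mul_div, le_div_iff₀ hw, mul_comm _ w, mul_assoc,
        mul_comm F]
      exact hx.sum_norm_iterate_succ_sub_sq_le hw.le he hn hed hc hQ k
  refine ⟨z, fun i => ?_, frameMap_eq_id_of_tendsto hz ?_, ?_⟩
  · have hnorm : ∀ k, ‖(scalingStep w)^[k] x i‖ = 1 := fun k =>
      (hx.iterate_scalingStep hw.le he hn k).1 i
    exact tendsto_nhds_unique (hz i).norm (by simp only [hnorm, tendsto_const_nhds])
  · refine squeeze_zero (fun _ => frobeniusSq_nonneg _)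
      (hx.frobeniusSq_frameError_iterate_le hw.le he hn hed hc hQ) ?_
    have hpow := tendsto_pow_atTop_nhds_zero_of_lt_one (r := (9 / 10 : ℝ)) (by norm_num)
      (by norm_num)
    simpa using (hpow.pow 2).mul_const F
  · rw [div_pow, hC] at hxz
    calc w * ∑ i, ‖x i - z i‖ ^ 2 ≤ w * (5 / 4 * F / w / (1 - 9 / 10) ^ 2) := by gcongr; exact hxz
      _ = 125 * F := by field_simp; ring

end ScalingLimit

section SphereInvariance

open Module Set Metric
open scoped RealInnerProductSpace Pointwise

variable {E : Type*} [NormedAddCommGroup E] [InnerProductSpace ℝ E]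

/-- The action of a linear isometry on the unit sphere. -/
def sphereMap (L : E ≃ₗᵢ[ℝ] E) (x : sphere (0 : E) 1) : sphere (0 : E) 1 :=
  ⟨L x, by simp⟩

theorem sphereMap_symm_apply (L : E ≃ₗᵢ[ℝ] E) (x : sphere (0 : E) 1) :
    sphereMap L (sphereMap L.symm x) = x :=
  Subtype.ext (L.apply_symm_apply x)

theorem preimage_cone_eq_cone_preimage (L : E ≃ₗᵢ[ℝ] E) (A : Set ℝ) (s : Set (sphere (0 : E) 1)) :
    L ⁻¹' (A • ((↑) '' s)) = A • ((↑) '' (sphereMap L ⁻¹' s)) := by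
  ext v
  simp only [mem_preimage, mem_smul, mem_image]
  constructor
  · rintro ⟨c, hc, _, ⟨y, hy, rfl⟩, h⟩
    refine ⟨c, hc, _, ⟨sphereMap L.symm y, by rwa [sphereMap_symm_apply], rfl⟩, L.injective ?_⟩
    simpa [sphereMap] using h
  · rintro ⟨c, hc, _, ⟨y, hy, rfl⟩, rfl⟩
    exact ⟨c, hc, _, ⟨sphereMap L y, hy, rfl⟩, by simp [sphereMap]⟩

variable [MeasurableSpace E] [BorelSpace E]

theorem measurable_sphereMap (L : E ≃ₗᵢ[ℝ] E) : Measurable (sphereMap L) :=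
  (L.continuous.measurable.comp measurable_subtype_coe).subtype_mk

theorem measurePreserving_sphereMap [FiniteDimensional ℝ E] (L : E ≃ₗᵢ[ℝ] E) :
    MeasurePreserving (sphereMap L) (volume : Measure E).toSphere
      (volume : Measure E).toSphere := by
  refine ⟨measurable_sphereMap L, Measure.ext fun s hs => ?_⟩
  rw [Measure.map_apply (measurable_sphereMap L) hs, Measure.toSphere_apply' _ hs,
    Measure.toSphere_apply' _ (measurable_sphereMap L hs), ← preimage_cone_eq_cone_preimage]
  exact congrArg _ (L.measurePreserving.measure_preimage_equiv (f := L.toMeasurableEquiv) _)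

end SphereInvariance

section SphereMoments

open Module Set
open scoped RealInnerProductSpace

variable {d : ℕ}

theorem map_smul_uniformSphere (r : ℝ) :
    (uniformSphere d 1).map (fun x => r • x) = uniformSphere d r := by
  rw [uniformSphere, uniformSphere, Measure.map_map (by fun_prop) (by fun_prop)]
  simp only [Function.comp_def, one_smul]

theorem norm_eq_one_ae_uniformSphere : ∀ᵐ x ∂uniformSphere d 1, ‖x‖ = 1 := by
  rw [uniformSphere, ae_map_iff (Measurable.aemeasurable (by fun_prop))
    (measurableSet_eq_fun (by fun_prop) (by fun_prop))]
  exact Filter.Eventually.of_forall fun x => by simp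

theorem map_isometry_uniformSphere
    (L : EuclideanSpace ℝ (Fin d) ≃ₗᵢ[ℝ] EuclideanSpace ℝ (Fin d)) :
    (uniformSphere d 1).map L = uniformSphere d 1 := by
  have hinv := (measurePreserving_sphereMap L).smul_measure
    ((volume : Measure (EuclideanSpace ℝ (Fin d))).toSphere univ)⁻¹
  rw [uniformSphere, Measure.map_map L.continuous.measurable (by fun_prop)]
  nth_rw 2 [← hinv.map_eq]
  rw [Measure.map_map (by fun_prop) hinv.measurable]
  congr 1
  funext x
  simp [sphereMap]

theorem integral_inner_pow_congr {u v : EuclideanSpace ℝ (Fin d)} (h : ‖u‖ = ‖v‖) (k : ℕ) :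
    ∫ x, ⟪x, u⟫ ^ k ∂uniformSphere d 1 = ∫ x, ⟪x, v⟫ ^ k ∂uniformSphere d 1 := by
  set L := (ℝ ∙ (u - v))ᗮ.reflection
  have hL : L u = v := Submodule.reflection_sub h
  conv_rhs => rw [← map_isometry_uniformSphere L, ← hL]
  rw [integral_map L.continuous.measurable.aemeasurable (by fun_prop)]
  simp only [L.inner_map_map]

variable [NeZero d]

instance isProbabilityMeasure_uniformSphere (r : ℝ) :
    IsProbabilityMeasure (uniformSphere d r) := by
  have : IsProbabilityMeasure
      (((volume : Measure (EuclideanSpace ℝ (Fin d))).toSphere univ)⁻¹ •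
        (volume : Measure (EuclideanSpace ℝ (Fin d))).toSphere) := by
    refine ⟨?_⟩
    rw [Measure.smul_apply, smul_eq_mul]
    exact ENNReal.inv_mul_cancel (Measure.measure_univ_ne_zero.2 (Measure.toSphere_ne_zero _))
      (measure_ne_top _ _)
  exact Measure.isProbabilityMeasure_map (Measurable.aemeasurable (by fun_prop))

theorem integrable_uniformSphere {f : EuclideanSpace ℝ (Fin d) → ℝ} (hf : Continuous f) :
    Integrable f (uniformSphere d 1) := by
  obtain ⟨C, hC⟩ := (isCompact_closedBall (0 : EuclideanSpace ℝ (Fin d))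
    1).exists_bound_of_continuousOn hf.continuousOn
  refine Integrable.of_bound hf.aestronglyMeasurable C ?_
  filter_upwards [norm_eq_one_ae_uniformSphere] with x hx
  exact hC x (by simp [hx])

/-- The even moments of a coordinate of a uniform point of the unit sphere. -/
noncomputable def sphereMoment (d k : ℕ) [NeZero d] : ℝ :=
  ∫ x, ⟪x, EuclideanSpace.basisFun (Fin d) ℝ 0⟫ ^ (2 * k) ∂uniformSphere d 1

theorem integral_inner_pow (v : EuclideanSpace ℝ (Fin d)) (k : ℕ) :
    ∫ x, ⟪x, v⟫ ^ (2 * k) ∂uniformSphere d 1 = sphereMoment d k * ‖v‖ ^ (2 * k) := by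
  have hv : ‖v‖ = ‖‖v‖ • EuclideanSpace.basisFun (Fin d) ℝ 0‖ := by
    rw [norm_smul, OrthonormalBasis.norm_eq_one, mul_one, norm_norm]
  rw [integral_inner_pow_congr hv]
  simp only [inner_smul_right, mul_pow]
  rw [integral_const_mul, mul_comm, sphereMoment]

theorem sphereMoment_nonneg (k : ℕ) : 0 ≤ sphereMoment d k :=
  integral_nonneg fun _ => (even_two_mul k).pow_nonneg _

theorem sphereMoment_zero : sphereMoment d 0 = 1 := by
  simp [sphereMoment]

theorem coeff_two_of_binomial_sum_eq {k : ℕ} {I : ℕ → ℝ} {m : ℝ}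
    (h : ∀ s : ℝ, ∑ j ∈ Finset.range (2 * (k + 1) + 1), s ^ j * (2 * (k + 1)).choose j * I j =
      m * (1 + s ^ 2) ^ (k + 1)) : (2 * k + 1) * I 2 = m := by
  set p : Polynomial ℝ := ∑ j ∈ Finset.range (2 * (k + 1) + 1),
    Polynomial.monomial j ((2 * (k + 1)).choose j * I j) with hp
  set q : Polynomial ℝ := Polynomial.C m * Polynomial.expand ℝ 2 ((1 + Polynomial.X) ^ (k + 1))
    with hq
  have hpq : p = q := Polynomial.funext fun s => by
    have heval : p.eval s = m * (1 + s ^ 2) ^ (k + 1) := by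
      rw [← h]
      simp only [hp, Polynomial.eval_finsetSum, Polynomial.eval_monomial]
      exact Finset.sum_congr rfl fun j _ => by ring
    simp [heval, hq]
  have hp2 : p.coeff 2 = (2 * (k + 1)).choose 2 * I 2 := by
    simp [hp, Polynomial.coeff_monomial]
  have hq2 : q.coeff 2 = m * (k + 1) := by
    have := Polynomial.coeff_expand_mul (R := ℝ) two_pos ((1 + Polynomial.X) ^ (k + 1)) 1
    rw [one_mul] at this
    rw [hq, Polynomial.coeff_C_mul, this, Polynomial.coeff_one_add_X_pow]
    simp
  rw [hpq, hq2, Nat.cast_choose_two] at hp2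
  push_cast at hp2
  have hk : (k : ℝ) + 1 ≠ 0 := by positivity
  refine mul_right_cancel₀ hk ?_
  linear_combination -hp2

theorem integral_inner_pow_mul_inner_sq {e f : EuclideanSpace ℝ (Fin d)} (he : ‖e‖ = 1)
    (hf : ‖f‖ = 1) (hef : ⟪e, f⟫ = 0) (k : ℕ) :
    (2 * k + 1) * ∫ x, ⟪x, e⟫ ^ (2 * k) * ⟪x, f⟫ ^ 2 ∂uniformSphere d 1 =
      sphereMoment d (k + 1) := by
  refine coeff_two_of_binomial_sum_eq
    (I := fun j => ∫ x, ⟪x, e⟫ ^ (2 * (k + 1) - j) * ⟪x, f⟫ ^ j ∂uniformSphere d 1) fun s => ?_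
  have hnorm : ‖e + s • f‖ ^ 2 = 1 + s ^ 2 := by
    rw [norm_add_sq_real, inner_smul_right, hef, norm_smul, he, hf]
    simp
  have hbinom : ∀ x : EuclideanSpace ℝ (Fin d), ⟪x, e + s • f⟫ ^ (2 * (k + 1)) =
      ∑ j ∈ Finset.range (2 * (k + 1) + 1), s ^ j * (2 * (k + 1)).choose j *
        (⟪x, e⟫ ^ (2 * (k + 1) - j) * ⟪x, f⟫ ^ j) := fun x => by
    rw [inner_add_right, inner_smul_right, add_comm, add_pow]
    exact Finset.sum_congr rfl fun j _ => by ring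
  rw [← hnorm, ← pow_mul, ← integral_inner_pow]
  simp only [hbinom]
  rw [integral_finsetSum _ fun j _ => integrable_uniformSphere (by fun_prop)]
  simp only [integral_const_mul]

theorem sphereMoment_succ (k : ℕ) :
    (d + 2 * k) * sphereMoment d (k + 1) = (2 * k + 1) * sphereMoment d k := by
  set b := EuclideanSpace.basisFun (Fin d) ℝ
  have hsum : sphereMoment d k =
      ∑ j, ∫ x, ⟪x, b 0⟫ ^ (2 * k) * ⟪x, b j⟫ ^ 2 ∂uniformSphere d 1 := by
    rw [← integral_finsetSum _ fun j _ => integrable_uniformSphere (by fun_prop)]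
    refine integral_congr_ae ?_
    filter_upwards [norm_eq_one_ae_uniformSphere] with x hx
    rw [← Finset.mul_sum, b.sum_sq_inner_left, hx, one_pow, mul_one]
  have hne : ∀ j ∈ Finset.univ.erase 0, (2 * k + 1) *
      ∫ x, ⟪x, b 0⟫ ^ (2 * k) * ⟪x, b j⟫ ^ 2 ∂uniformSphere d 1 = sphereMoment d (k + 1) :=
    fun j hj => integral_inner_pow_mul_inner_sq (b.norm_eq_one _) (b.norm_eq_one _)
      (b.orthonormal.2 (Finset.ne_of_mem_erase hj).symm) k
  have heq : ∫ x, ⟪x, b 0⟫ ^ (2 * k) * ⟪x, b 0⟫ ^ 2 ∂uniformSphere d 1 =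
      sphereMoment d (k + 1) := by
    simp only [← pow_add]
    rfl
  rw [hsum, Finset.mul_sum, ← Finset.add_sum_erase _ _ (Finset.mem_univ 0), heq,
    Finset.sum_congr rfl hne]
  simp [Finset.card_erase_of_mem, Nat.cast_sub (NeZero.one_le (n := d))]
  ring

theorem sphereMoment_two : sphereMoment d 2 = 3 / (d * (d + 2)) := by
  have h0 := sphereMoment_succ (d := d) 0
  have h1 := sphereMoment_succ (d := d) 1
  rw [sphereMoment_zero] at h0
  have : (d : ℝ) ≠ 0 := NeZero.ne _
  norm_num at h0 h1
  rw [eq_div_iff (by positivity)]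
  linear_combination d * h1 + 3 * h0

theorem sphereMoment_le (k : ℕ) : (d : ℝ) ^ k * sphereMoment d k ≤ 2 ^ k * k.factorial := by
  induction k with
  | zero => simp [sphereMoment_zero]
  | succ k ih =>
    have hstep : d * sphereMoment d (k + 1) ≤ 2 * (k + 1) * sphereMoment d k := by
      have hrec := sphereMoment_succ (d := d) k
      have := sphereMoment_nonneg (d := d) k
      nlinarith [mul_nonneg k.cast_nonneg (sphereMoment_nonneg (d := d) (k + 1))]
    calc (d : ℝ) ^ (k + 1) * sphereMoment d (k + 1) = d ^ k * (d * sphereMoment d (k + 1)) := by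
          ring
      _ ≤ d ^ k * (2 * (k + 1) * sphereMoment d k) := by gcongr
      _ = 2 * (k + 1) * (d ^ k * sphereMoment d k) := by ring
      _ ≤ 2 * (k + 1) * (2 ^ k * k.factorial) := by gcongr
      _ = 2 ^ (k + 1) * (k + 1).factorial := by
          rw [Nat.factorial_succ]
          push_cast
          ring

theorem integral_exp_term_le {v : EuclideanSpace ℝ (Fin d)} (hv : ‖v‖ = 1) (k : ℕ) :
    ∫ x, (d * ⟪x, v⟫ ^ 2 / 4) ^ k / k.factorial ∂uniformSphere d 1 ≤ (1 / 2) ^ k := by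
  have hterm : ∀ x : EuclideanSpace ℝ (Fin d), (d * ⟪x, v⟫ ^ 2 / 4) ^ k / k.factorial =
      (1 / 4 : ℝ) ^ k / k.factorial * d ^ k * ⟪x, v⟫ ^ (2 * k) := fun x => by
    rw [div_eq_mul_one_div _ (4 : ℝ), mul_pow, mul_pow, ← pow_mul]
    ring
  simp only [hterm]
  rw [integral_const_mul, integral_inner_pow v, hv, one_pow, mul_one, mul_assoc]
  calc (1 / 4 : ℝ) ^ k / k.factorial * (d ^ k * sphereMoment d k)
      ≤ (1 / 4 : ℝ) ^ k / k.factorial * (2 ^ k * k.factorial) :=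
        mul_le_mul_of_nonneg_left (sphereMoment_le k) (by positivity)
    _ = (1 / 2) ^ k := by
        field_simp
        rw [← mul_pow]
        norm_num

theorem integral_exp_inner_sq_le {v : EuclideanSpace ℝ (Fin d)} (hv : ‖v‖ = 1) :
    ∫ x, Real.exp (d * ⟪x, v⟫ ^ 2 / 4) ∂uniformSphere d 1 ≤ 2 := by
  have hint : ∀ k : ℕ, Integrable (fun x => (d * ⟪x, v⟫ ^ 2 / 4) ^ k / k.factorial)
      (uniformSphere d 1) := fun k => integrable_uniformSphere (by fun_prop)
  have hsummable : Summable fun k : ℕ =>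
      ∫ x, ‖(d * ⟪x, v⟫ ^ 2 / 4) ^ k / k.factorial‖ ∂uniformSphere d 1 := by
    refine .of_nonneg_of_le (fun k => integral_nonneg fun _ => norm_nonneg _) (fun k => ?_)
      summable_geometric_two
    refine le_of_eq_of_le (integral_congr_ae (.of_forall fun x => ?_)) (integral_exp_term_le hv k)
    exact Real.norm_of_nonneg (by positivity)
  have hsum := hasSum_integral_of_summable_integral_norm hint hsummable
  have hexp : ∀ x, ∑' k : ℕ, (d * ⟪x, v⟫ ^ 2 / 4) ^ k / k.factorial =
      Real.exp (d * ⟪x, v⟫ ^ 2 / 4) := fun x => by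
    rw [Real.exp_eq_exp_ℝ, NormedSpace.exp_eq_tsum_div]
  simp only [hexp] at hsum
  exact hasSum_le (integral_exp_term_le hv) hsum hasSum_geometric_two

end SphereMoments

section SphereQuadraticForms

open Module
open scoped RealInnerProductSpace

section Operators

variable {E : Type*} [NormedAddCommGroup E] [InnerProductSpace ℝ E] [FiniteDimensional ℝ E]

theorem inner_apply_self_eq_sum_eigenvalues {n : ℕ} {X : E →ₗ[ℝ] E} (hX : X.IsSymmetric)
    (hn : finrank ℝ E = n) (x : E) :
    ⟪x, X x⟫ = ∑ k, hX.eigenvalues hn k * ⟪x, hX.eigenvectorBasis hn k⟫ ^ 2 := by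
  rw [← (hX.eigenvectorBasis hn).sum_inner_mul_inner]
  refine Finset.sum_congr rfl fun k _ => ?_
  rw [← hX, hX.apply_eigenvectorBasis, inner_smul_left, real_inner_comm x]
  simp only [RCLike.ofReal_real_eq_id, id_eq, conj_trivial]
  ring

theorem frobeniusSq_eq_sum_eigenvalues_sq {n : ℕ} {X : E →ₗ[ℝ] E} (hX : X.IsSymmetric)
    (hn : finrank ℝ E = n) : frobeniusSq X = ∑ k, hX.eigenvalues hn k ^ 2 := by
  simp [frobeniusSq_eq_sum_norm_sq (hX.eigenvectorBasis hn), hX.apply_eigenvectorBasis, norm_smul]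

theorem frobeniusSq_symmetrization_le (V : E →ₗ[ℝ] E) :
    frobeniusSq ((1 / 2 : ℝ) • (V + V.adjoint)) ≤ frobeniusSq V := by
  set b := stdOrthonormalBasis ℝ E
  have hle : ∀ a, ‖((1 / 2 : ℝ) • (V + V.adjoint)) (b a)‖ ^ 2 ≤
      (‖V (b a)‖ ^ 2 + ‖V.adjoint (b a)‖ ^ 2) / 2 := fun a => by
    rw [LinearMap.smul_apply, LinearMap.add_apply, norm_smul, mul_pow, norm_add_sq_real]
    norm_num
    nlinarith [norm_sub_sq_real (V (b a)) (V.adjoint (b a)),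
      sq_nonneg ‖V (b a) - V.adjoint (b a)‖]
  calc frobeniusSq ((1 / 2 : ℝ) • (V + V.adjoint))
      ≤ ∑ a, (‖V (b a)‖ ^ 2 + ‖V.adjoint (b a)‖ ^ 2) / 2 := by
        rw [frobeniusSq_eq_sum_norm_sq b]
        exact Finset.sum_le_sum fun a _ => hle a
    _ = (frobeniusSq V + frobeniusSq V.adjoint) / 2 := by
        rw [← Finset.sum_div, Finset.sum_add_distrib, ← frobeniusSq_eq_sum_norm_sq,
          ← frobeniusSq_eq_sum_norm_sq]
    _ = frobeniusSq V := by
        rw [frobeniusSq_adjoint, add_self_div_two]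

theorem frobeniusSq_sub_smul_id_le (X : E →ₗ[ℝ] E) :
    frobeniusSq (X - (LinearMap.trace ℝ E X / finrank ℝ E) • LinearMap.id) ≤ frobeniusSq X := by
  set b := stdOrthonormalBasis ℝ E
  set t := LinearMap.trace ℝ E X with ht
  set n : ℝ := (finrank ℝ E : ℝ) with hn
  set Y : E →ₗ[ℝ] E := X - (t / n) • LinearMap.id with hY
  have hsum : frobeniusSq Y = frobeniusSq X - 2 * (t / n) * t + n * (t / n) ^ 2 := by
    have hterm : ∀ a, ‖Y (b a)‖ ^ 2 =
        ‖X (b a)‖ ^ 2 - 2 * (t / n) * ⟪b a, X (b a)⟫ + (t / n) ^ 2 := fun a => by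
      simp only [hY, LinearMap.sub_apply, LinearMap.smul_apply, LinearMap.id_apply,
        norm_sub_sq_real, inner_smul_right, norm_smul, b.norm_eq_one, real_inner_comm (X (b a)),
        mul_pow, Real.norm_eq_abs, sq_abs]
      ring
    simp [frobeniusSq_eq_sum_norm_sq b, hterm, Finset.sum_add_distrib, ← Finset.mul_sum,
      ht, LinearMap.trace_eq_sum_inner X b, hn]
  have hmean : n * (t / n) ^ 2 = t / n * t := by
    rcases eq_or_ne n 0 with h | h
    · simp [h]
    · field_simp
  have : 0 ≤ t / n * t := by
    rw [div_mul_eq_mul_div]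
    exact div_nonneg (mul_self_nonneg t) (Nat.cast_nonneg _)
  linarith

theorem exists_isSymmetric_trace_eq_zero [Nontrivial E] (V : E →ₗ[ℝ] E) :
    ∃ X : E →ₗ[ℝ] E, X.IsSymmetric ∧ LinearMap.trace ℝ E X = 0 ∧ frobeniusSq X ≤ frobeniusSq V ∧
      ∀ x, ⟪x, X x⟫ = ⟪x, V x⟫ - LinearMap.trace ℝ E V / finrank ℝ E * ‖x‖ ^ 2 := by
  set S : E →ₗ[ℝ] E := (1 / 2 : ℝ) • (V + V.adjoint) with hS
  have hinner : ∀ x y, ⟪x, S y⟫ = (⟪x, V y⟫ + ⟪V x, y⟫) / 2 := fun x y => by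
    simp only [hS, LinearMap.smul_apply, LinearMap.add_apply, inner_smul_right, inner_add_right,
      LinearMap.adjoint_inner_right]
    ring
  have hsymm : S.IsSymmetric := fun x y => by
    rw [real_inner_comm, hinner, hinner, real_inner_comm (V x), real_inner_comm x, add_comm]
  have htrace : LinearMap.trace ℝ E S = LinearMap.trace ℝ E V := by
    simp [LinearMap.trace_eq_sum_inner _ (stdOrthonormalBasis ℝ E), hinner,
      real_inner_comm (V _)]
  refine ⟨S - (LinearMap.trace ℝ E S / finrank ℝ E) • LinearMap.id, fun x y => ?_, ?_,
    (frobeniusSq_sub_smul_id_le S).trans (frobeniusSq_symmetrization_le V), fun x => ?_⟩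
  · simp [inner_sub_left, inner_sub_right, inner_smul_left, inner_smul_right, hsymm x y]
  · have : (finrank ℝ E : ℝ) ≠ 0 := by exact_mod_cast finrank_pos.ne'
    simp [this]
  · simp only [LinearMap.sub_apply, LinearMap.smul_apply, LinearMap.id_apply, inner_sub_right,
      inner_smul_right, hinner, htrace, real_inner_self_eq_norm_sq, real_inner_comm (V x),
      add_self_div_two]

end Operators

variable {d : ℕ}

/-- The entries of `x xᵀ - I / d`, the traceless part of `x xᵀ` when `x` is a unit vector. -/
noncomputable def tracelessSquare (x : EuclideanSpace ℝ (Fin d)) (p : Fin d × Fin d) : ℝ :=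
  x p.1 * x p.2 - if p.1 = p.2 then 1 / (d : ℝ) else 0

theorem continuous_tracelessSquare :
    Continuous (tracelessSquare : EuclideanSpace ℝ (Fin d) → Fin d × Fin d → ℝ) := by
  unfold tracelessSquare
  fun_prop

/-- The matrix entries of an operator on Euclidean space, as a vector indexed by pairs. -/
noncomputable def operatorEntries (V : EuclideanSpace ℝ (Fin d) →ₗ[ℝ] EuclideanSpace ℝ (Fin d))
    (p : Fin d × Fin d) : ℝ :=
  ⟪EuclideanSpace.basisFun (Fin d) ℝ p.1, V (EuclideanSpace.basisFun (Fin d) ℝ p.2)⟫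

theorem exists_operatorEntries_eq (v : Fin d × Fin d → ℝ) : ∃ V, operatorEntries V = v :=
  ⟨Matrix.toEuclideanLin (Matrix.of fun a b => v (a, b)), funext fun p => by
    simp [operatorEntries, Matrix.toLpLin_apply, EuclideanSpace.inner_single_left]⟩

theorem operatorEntries_dotProduct_self
    (V : EuclideanSpace ℝ (Fin d) →ₗ[ℝ] EuclideanSpace ℝ (Fin d)) :
    operatorEntries V ⬝ᵥ operatorEntries V = frobeniusSq V := by
  set b := EuclideanSpace.basisFun (Fin d) ℝ
  simp only [dotProduct, operatorEntries, ← sq, Fintype.sum_prod_type_right,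
    frobeniusSq_eq_sum_norm_sq b]
  exact Finset.sum_congr rfl fun j _ => b.sum_sq_inner_right _

theorem operatorEntries_dotProduct_tracelessSquare
    (V : EuclideanSpace ℝ (Fin d) →ₗ[ℝ] EuclideanSpace ℝ (Fin d))
    (x : EuclideanSpace ℝ (Fin d)) :
    operatorEntries V ⬝ᵥ tracelessSquare x = ⟪x, V x⟫ - LinearMap.trace ℝ _ V / d := by
  set b := EuclideanSpace.basisFun (Fin d) ℝ with hb
  have hVx : V x = ∑ j, x j • V (b j) := by
    conv_lhs => rw [← b.sum_repr x]
    simp [hb]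
  have hinner : ⟪x, V x⟫ = ∑ i, ∑ j, ⟪b i, V (b j)⟫ * (x i * x j) := by
    rw [← b.sum_inner_mul_inner x (V x)]
    refine Finset.sum_congr rfl fun i _ => ?_
    rw [hVx, inner_sum, Finset.mul_sum, hb, EuclideanSpace.inner_basisFun_real]
    refine Finset.sum_congr rfl fun j _ => ?_
    rw [inner_smul_right]
    ring
  have htrace : LinearMap.trace ℝ _ V / d =
      ∑ i, ∑ j, ⟪b i, V (b j)⟫ * if i = j then 1 / (d : ℝ) else 0 := by
    simp [LinearMap.trace_eq_sum_inner V b, Finset.sum_mul, div_eq_mul_inv]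
  simp only [hinner, htrace, dotProduct, operatorEntries, tracelessSquare, Fintype.sum_prod_type,
    mul_sub, Finset.sum_sub_distrib, ← hb]

variable [NeZero d]

theorem tracelessSquare_dotProduct_self_le_one {x : EuclideanSpace ℝ (Fin d)} (hx : ‖x‖ = 1) :
    tracelessSquare x ⬝ᵥ tracelessSquare x ≤ 1 := by
  have hsum : ∑ a, x a ^ 2 = 1 := by
    rw [← EuclideanSpace.real_norm_sq_eq, hx, one_pow]
  have hsq : ∀ a b : Fin d, tracelessSquare x (a, b) ^ 2 = x a ^ 2 * x b ^ 2 +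
      if a = b then (1 / (d : ℝ)) ^ 2 - 2 * (1 / d) * x a ^ 2 else 0 := fun a b => by
    simp only [tracelessSquare]
    split_ifs with h
    · subst h
      ring
    · ring
  simp only [dotProduct, ← sq, Fintype.sum_prod_type, hsq, Finset.sum_add_distrib, ← Finset.mul_sum,
    Finset.sum_ite_eq, Finset.mem_univ, if_true, hsum, Finset.sum_sub_distrib, mul_one]
  have hd : (d : ℝ) * (1 / d) ^ 2 = 1 / d := by
    have : (d : ℝ) ≠ 0 := NeZero.ne _
    field_simp
  have : 0 ≤ 1 / (d : ℝ) := by positivity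
  simp only [Finset.sum_const, Finset.card_univ, Fintype.card_fin, nsmul_eq_mul, hd]
  linarith

theorem integral_inner_sq_mul_inner_sq {ι : Type*} [DecidableEq ι]
    {c : ι → EuclideanSpace ℝ (Fin d)} (hc : Orthonormal ℝ c) (k j : ι) :
    ∫ x, ⟪x, c k⟫ ^ 2 * ⟪x, c j⟫ ^ 2 ∂uniformSphere d 1 =
      (1 + if k = j then 2 else 0) / (d * (d + 2)) := by
  split_ifs with h
  · subst h
    have := integral_inner_pow (c k) 2
    rw [hc.1, one_pow, mul_one, sphereMoment_two] at this
    simp only [← pow_add]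
    refine this.trans ?_
    ring
  · have := integral_inner_pow_mul_inner_sq (hc.1 k) (hc.1 j) (hc.2 h) 1
    rw [sphereMoment_two] at this
    simp only [mul_one, Nat.cast_one] at this
    linear_combination this / 3

theorem integral_inner_apply_sq {X : EuclideanSpace ℝ (Fin d) →ₗ[ℝ] EuclideanSpace ℝ (Fin d)}
    (hX : X.IsSymmetric) (htr : LinearMap.trace ℝ _ X = 0) :
    ∫ x, ⟪x, X x⟫ ^ 2 ∂uniformSphere d 1 = 2 / (d * (d + 2)) * frobeniusSq X := by
  set c := hX.eigenvectorBasis finrank_euclideanSpace_fin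
  set l := hX.eigenvalues finrank_euclideanSpace_fin
  have hl : ∑ k, l k = 0 := by
    rw [← htr, hX.trace_eq_sum_eigenvalues finrank_euclideanSpace_fin]
    rfl
  have hexpand : ∀ x, ⟪x, X x⟫ ^ 2 = ∑ k, ∑ j, l k * l j * (⟪x, c k⟫ ^ 2 * ⟪x, c j⟫ ^ 2) :=
    fun x => by
      rw [inner_apply_self_eq_sum_eigenvalues hX finrank_euclideanSpace_fin, sq,
        Finset.sum_mul_sum]
      exact Finset.sum_congr rfl fun k _ => Finset.sum_congr rfl fun j _ => by ring
  have hswap : ∫ x, ⟪x, X x⟫ ^ 2 ∂uniformSphere d 1 =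
      ∑ k, ∑ j, l k * l j * ((1 + if k = j then 2 else 0) / (d * (d + 2))) := by
    simp only [hexpand]
    rw [integral_finsetSum _ fun k _ => integrable_uniformSphere (by fun_prop)]
    refine Finset.sum_congr rfl fun k _ => ?_
    rw [integral_finsetSum _ fun j _ => integrable_uniformSphere (by fun_prop)]
    simp only [integral_const_mul, integral_inner_sq_mul_inner_sq c.orthonormal]
  calc ∫ x, ⟪x, X x⟫ ^ 2 ∂uniformSphere d 1
      = ((∑ k, l k) * (∑ j, l j) + 2 * ∑ k, l k ^ 2) / (d * (d + 2)) := by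
        rw [hswap, Finset.sum_mul_sum]
        simp only [mul_div_assoc', ← Finset.sum_div, mul_add, mul_one, mul_ite, mul_zero,
          Finset.sum_add_distrib, Finset.sum_ite_eq, Finset.mem_univ, if_true, ← Finset.sum_mul]
        simp only [← sq, mul_comm]
    _ = 2 / (d * (d + 2)) * frobeniusSq X := by
        rw [hl, frobeniusSq_eq_sum_eigenvalues_sq hX finrank_euclideanSpace_fin]
        ring

theorem integral_dotProduct_tracelessSquare_sq_le (v : Fin d × Fin d → ℝ) :
    ∫ x, (v ⬝ᵥ tracelessSquare x) ^ 2 ∂uniformSphere d 1 ≤ 2 / (d * (d + 2)) * (v ⬝ᵥ v) := by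
  obtain ⟨V, rfl⟩ := exists_operatorEntries_eq v
  obtain ⟨X, hX, htr, hFrob, hinner⟩ := exists_isSymmetric_trace_eq_zero V
  calc ∫ x, (operatorEntries V ⬝ᵥ tracelessSquare x) ^ 2 ∂uniformSphere d 1
      = ∫ x, ⟪x, X x⟫ ^ 2 ∂uniformSphere d 1 := by
        refine integral_congr_ae (norm_eq_one_ae_uniformSphere.mono fun x hx => ?_)
        simp only [operatorEntries_dotProduct_tracelessSquare, hinner, hx, one_pow, mul_one,
          finrank_euclideanSpace_fin]
    _ = 2 / (d * (d + 2)) * frobeniusSq X := integral_inner_apply_sq hX htr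
    _ ≤ 2 / (d * (d + 2)) * frobeniusSq V := by gcongr
    _ = 2 / (d * (d + 2)) * (operatorEntries V ⬝ᵥ operatorEntries V) := by
        rw [operatorEntries_dotProduct_self]

end SphereQuadraticForms

section RandomMatrices

open Matrix

variable {ι κ : Type*}

section Trace

variable {T Z W : Matrix ι ι ℝ} {c : ℝ}

theorem isSymm_sum {Z : κ → Matrix ι ι ℝ} (hZ : ∀ i, (Z i).IsSymm) (s : Finset κ) :
    (∑ i ∈ s, Z i).IsSymm := by
  rw [IsSymm, transpose_sum]
  exact Finset.sum_congr rfl fun i _ => hZ i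

variable [Fintype ι]

theorem trace_transpose_mul_self_nonneg (A : Matrix ι ι ℝ) : 0 ≤ (Aᵀ * A).trace := by
  simpa using (posSemidef_conjTranspose_mul_self A).trace_nonneg

theorem dotProduct_sq_le (u v : ι → ℝ) : (u ⬝ᵥ v) ^ 2 ≤ (u ⬝ᵥ u) * (v ⬝ᵥ v) := by
  simpa only [dotProduct, sq] using Finset.sum_mul_sq_le_sq_mul_sq Finset.univ u v

variable [DecidableEq ι]

theorem trace_sq_nonneg (hT : T.IsSymm) : 0 ≤ (T ^ 2).trace := by
  simpa only [hT.eq, ← sq] using trace_transpose_mul_self_nonneg T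

theorem trace_pow_four_nonneg (hT : T.IsSymm) : 0 ≤ (T ^ 4).trace := by
  rw [pow_mul T 2 2]
  exact trace_sq_nonneg (hT.pow 2)

theorem trace_add_sq (T Z : Matrix ι ι ℝ) :
    ((T + Z) ^ 2).trace = (T ^ 2).trace + 2 * (T * Z).trace + (Z ^ 2).trace := by
  simp only [sq, add_mul, mul_add, trace_add, trace_mul_comm Z T]
  ring

theorem trace_sub_sq_le (hT : T.IsSymm) (hZ : Z.IsSymm) :
    ((T - Z) ^ 2).trace ≤ 2 * (T ^ 2).trace + 2 * (Z ^ 2).trace := by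
  have hnonneg := trace_sq_nonneg (hT.add hZ)
  have hsub := trace_add_sq T (-Z)
  rw [trace_add_sq] at hnonneg
  rw [← sub_eq_add_neg, neg_sq, mul_neg, trace_neg] at hsub
  linarith

theorem trace_add_pow_four_le (hT : T.IsSymm) (hZ : Z.IsSymm) :
    ((T + Z) ^ 4).trace ≤ (T ^ 4).trace + 4 * (T ^ 3 * Z).trace +
      8 * (T ^ 2 * Z ^ 2).trace + 3 * (Z ^ 4).trace := by
  have h1 := trace_transpose_mul_self_nonneg (T * Z - Z * T)
  have h2 := trace_transpose_mul_self_nonneg (T * Z - Z * Z)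
  have cyclic := fun A B C D : Matrix ι ι ℝ => trace_mul_comm (A * B * C) D
  simp only [transpose_sub, transpose_mul, hT.eq, hZ.eq, sub_mul, mul_sub, trace_sub,
    ← mul_assoc] at h1 h2 cyclic
  simp only [pow_succ, pow_zero, one_mul, add_mul, mul_add, trace_add, ← mul_assoc]
  linarith [cyclic T T Z T, cyclic T Z T T, cyclic Z T T T, cyclic T T Z Z, cyclic T Z Z T,
    cyclic Z Z T T, cyclic Z T T Z, cyclic T Z T Z, cyclic Z T Z T, cyclic Z Z Z T,
    cyclic Z Z T Z, cyclic Z T Z Z, cyclic T Z Z Z]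

theorem trace_sq_mul_eq_sum (hT : T.IsSymm) (W : Matrix ι ι ℝ) :
    (T ^ 2 * W).trace = ∑ k, T k ⬝ᵥ W *ᵥ T k := by
  calc (T ^ 2 * W).trace = (T * (W * Tᵀ)).trace := by
        rw [hT.eq, sq, mul_assoc, trace_mul_comm, mul_assoc]
    _ = ∑ k, T k ⬝ᵥ W *ᵥ T k := rfl

theorem trace_sq_eq_sum (hT : T.IsSymm) : (T ^ 2).trace = ∑ k, T k ⬝ᵥ T k := by
  simpa using trace_sq_mul_eq_sum hT 1

theorem trace_sq_mul_le (hT : T.IsSymm) (hW : ∀ v : ι → ℝ, v ⬝ᵥ W *ᵥ v ≤ c * (v ⬝ᵥ v)) :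
    (T ^ 2 * W).trace ≤ c * (T ^ 2).trace := by
  rw [trace_sq_mul_eq_sum hT, trace_sq_eq_sum hT, Finset.mul_sum]
  exact Finset.sum_le_sum fun k _ => hW _

theorem dotProduct_sq_mulVec (hT : T.IsSymm) (v : ι → ℝ) :
    v ⬝ᵥ T ^ 2 *ᵥ v = (T *ᵥ v) ⬝ᵥ (T *ᵥ v) := by
  rw [sq, ← mulVec_mulVec, dotProduct_mulVec, ← mulVec_transpose, hT.eq]

theorem dotProduct_sq_mulVec_le (hT : T.IsSymm) (v : ι → ℝ) :
    v ⬝ᵥ T ^ 2 *ᵥ v ≤ (T ^ 2).trace * (v ⬝ᵥ v) := by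
  rw [dotProduct_sq_mulVec hT, trace_sq_eq_sum hT, Finset.sum_mul]
  refine Finset.sum_le_sum fun k _ => ?_
  simpa only [mulVec, ← sq] using dotProduct_sq_le (T k) v

theorem dotProduct_mulVec_sq_le (hT : T.IsSymm) (v : ι → ℝ) :
    (v ⬝ᵥ T *ᵥ v) ^ 2 ≤ (v ⬝ᵥ v) * (v ⬝ᵥ T ^ 2 *ᵥ v) := by
  rw [dotProduct_sq_mulVec hT]
  exact dotProduct_sq_le v (T *ᵥ v)

theorem dotProduct_mulVec_pow_four_le (hT : T.IsSymm) (v : ι → ℝ) :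
    (v ⬝ᵥ T *ᵥ v) ^ 4 ≤ (T ^ 4).trace * (v ⬝ᵥ v) ^ 4 := by
  have hT4 : T ^ 4 = (T ^ 2) ^ 2 := by rw [← pow_mul]
  have hv : 0 ≤ v ⬝ᵥ v := Finset.sum_nonneg fun _ _ => mul_self_nonneg _
  calc (v ⬝ᵥ T *ᵥ v) ^ 4 = ((v ⬝ᵥ T *ᵥ v) ^ 2) ^ 2 := by ring
    _ ≤ ((v ⬝ᵥ v) * (v ⬝ᵥ T ^ 2 *ᵥ v)) ^ 2 :=
        pow_le_pow_left₀ (sq_nonneg _) (dotProduct_mulVec_sq_le hT v) 2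
    _ = (v ⬝ᵥ v) ^ 2 * (v ⬝ᵥ T ^ 2 *ᵥ v) ^ 2 := mul_pow _ _ 2
    _ ≤ (v ⬝ᵥ v) ^ 2 * ((v ⬝ᵥ v) * ((T ^ 4).trace * (v ⬝ᵥ v))) := by
        refine mul_le_mul_of_nonneg_left ?_ (sq_nonneg _)
        rw [hT4]
        exact (dotProduct_mulVec_sq_le (hT.pow 2) v).trans
          (mul_le_mul_of_nonneg_left (dotProduct_sq_mulVec_le (hT.pow 2) v) hv)
    _ = (T ^ 4).trace * (v ⬝ᵥ v) ^ 4 := by ring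

theorem trace_pow_four_le (hT : T.IsSymm) : (T ^ 4).trace ≤ (T ^ 2).trace ^ 2 := by
  rw [sq (trace _), show T ^ 4 = T ^ 2 * T ^ 2 by rw [← pow_add]]
  exact trace_sq_mul_le hT (dotProduct_sq_mulVec_le hT)

end Trace

/-- The product measurable structure on real matrices, needed to speak of independent random
matrices. -/
instance measurableSpaceMatrix : MeasurableSpace (Matrix ι ι ℝ) :=
  inferInstanceAs (MeasurableSpace (ι → ι → ℝ))

instance measurableAddMatrix : MeasurableAdd₂ (Matrix ι ι ℝ) :=
  inferInstanceAs (MeasurableAdd₂ (ι → ι → ℝ))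

theorem measurable_entry (a b : ι) : Measurable fun A : Matrix ι ι ℝ => A a b :=
  (measurable_pi_apply b).comp (measurable_pi_apply (X := fun _ : ι => ι → ℝ) a)

theorem measurable_of_entries {α : Type*} [MeasurableSpace α] {f : α → Matrix ι ι ℝ}
    (hf : ∀ a b, Measurable fun x => f x a b) : Measurable f :=
  measurable_pi_lambda (X := fun _ : ι => ι → ℝ) f fun a => measurable_pi_lambda _ fun b => hf a b

theorem measurable_matrix_pow [Fintype ι] [DecidableEq ι] (k : ℕ) :
    Measurable fun A : Matrix ι ι ℝ => A ^ k := by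
  induction k with
  | zero => simpa only [pow_zero] using measurable_const
  | succ k ih =>
    refine measurable_of_entries fun a b => ?_
    simp only [pow_succ, mul_apply]
    exact Finset.measurable_sum _ fun c _ =>
      ((measurable_entry a c).comp ih).mul (measurable_entry c b)

variable {Ω : Type*} [MeasurableSpace Ω] {P : Measure Ω}

/-- A random matrix with essentially bounded entries. -/
def BoundedEntries (P : Measure Ω) (A : Ω → Matrix ι ι ℝ) : Prop :=
  ∀ a b, MemLp (fun ω => A ω a b) ⊤ P

/-- The entrywise expectation of a random matrix. -/
noncomputable def meanMatrix (P : Measure Ω) (A : Ω → Matrix ι ι ℝ) : Matrix ι ι ℝ :=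
  Matrix.of fun a b => ∫ ω, A ω a b ∂P

theorem isSymm_meanMatrix {A : Ω → Matrix ι ι ℝ} (hA : ∀ ω, (A ω).IsSymm) :
    (meanMatrix P A).IsSymm :=
  .ext fun a b => by simp only [meanMatrix, of_apply, (hA _).apply a b]

section BoundedEntries

variable {A B : Ω → Matrix ι ι ℝ}

theorem BoundedEntries.add (hA : BoundedEntries P A) (hB : BoundedEntries P B) :
    BoundedEntries P fun ω => A ω + B ω :=
  fun a b => (hA a b).add (hB a b)

theorem BoundedEntries.sub (hA : BoundedEntries P A) (hB : BoundedEntries P B) :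
    BoundedEntries P fun ω => A ω - B ω :=
  fun a b => (hA a b).sub (hB a b)

theorem BoundedEntries.sum {Z : κ → Ω → Matrix ι ι ℝ} (hZ : ∀ i, BoundedEntries P (Z i))
    (s : Finset κ) : BoundedEntries P fun ω => ∑ i ∈ s, Z i ω := fun a b => by
  simp only [Matrix.sum_apply]
  exact memLp_finsetSum _ fun i _ => hZ i a b

theorem BoundedEntries.mul [Fintype ι] (hA : BoundedEntries P A) (hB : BoundedEntries P B) :
    BoundedEntries P fun ω => A ω * B ω := fun a b => by
  simp only [mul_apply]
  exact memLp_finsetSum _ fun c _ => (hB c b).mul (hA a c)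

variable [IsFiniteMeasure P]

theorem BoundedEntries.const (C : Matrix ι ι ℝ) : BoundedEntries P fun _ => C :=
  fun _ _ => memLp_const _

theorem BoundedEntries.integrable (hA : BoundedEntries P A) (a b : ι) :
    Integrable (fun ω => A ω a b) P :=
  (hA a b).integrable le_top

theorem BoundedEntries.meanMatrix_sub (hA : BoundedEntries P A) (hB : BoundedEntries P B) :
    meanMatrix P (fun ω => A ω - B ω) = meanMatrix P A - meanMatrix P B := by
  ext a b
  exact integral_sub (hA.integrable a b) (hB.integrable a b)

variable [Fintype ι]

theorem BoundedEntries.pow [DecidableEq ι] (hA : BoundedEntries P A) (k : ℕ) :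
    BoundedEntries P fun ω => A ω ^ k := by
  induction k with
  | zero => simpa only [pow_zero] using .const 1
  | succ k ih => simpa only [pow_succ] using ih.mul hA

theorem BoundedEntries.integrable_trace (hA : BoundedEntries P A) :
    Integrable (fun ω => (A ω).trace) P :=
  integrable_finsetSum _ fun a _ => hA.integrable a a

theorem BoundedEntries.integral_trace_mul_const (hA : BoundedEntries P A) (C : Matrix ι ι ℝ) :
    ∫ ω, (A ω * C).trace ∂P = (meanMatrix P A * C).trace := by
  simp only [trace, diag, mul_apply, meanMatrix, of_apply]
  rw [integral_finsetSum _ fun a _ => integrable_finsetSum _ fun b _ =>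
    (hA.integrable a b).mul_const _]
  refine Finset.sum_congr rfl fun a _ => ?_
  rw [integral_finsetSum _ fun b _ => (hA.integrable a b).mul_const _]
  simp only [integral_mul_const]

theorem BoundedEntries.integral_trace (hA : BoundedEntries P A) :
    ∫ ω, (A ω).trace ∂P = (meanMatrix P A).trace := by
  classical
  simpa only [mul_one] using hA.integral_trace_mul_const 1

theorem BoundedEntries.integrable_dotProduct_mulVec (hA : BoundedEntries P A) (v : ι → ℝ) :
    Integrable (fun ω => v ⬝ᵥ A ω *ᵥ v) P := by
  simpa only [mul_vecMulVec, trace_vecMulVec, dotProduct_comm _ v] using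
    (hA.mul (.const (vecMulVec v v))).integrable_trace

theorem BoundedEntries.integral_dotProduct_mulVec (hA : BoundedEntries P A) (v : ι → ℝ) :
    ∫ ω, v ⬝ᵥ A ω *ᵥ v ∂P = v ⬝ᵥ meanMatrix P A *ᵥ v := by
  simpa only [mul_vecMulVec, trace_vecMulVec, dotProduct_comm _ v] using
    hA.integral_trace_mul_const (vecMulVec v v)

theorem BoundedEntries.meanMatrix_mul_const (hA : BoundedEntries P A) (C : Matrix ι ι ℝ) :
    meanMatrix P (fun ω => A ω * C) = meanMatrix P A * C := by
  ext a b
  simp only [meanMatrix, of_apply, mul_apply]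
  rw [integral_finsetSum _ fun c _ => (hA.integrable a c).mul_const _]
  simp only [integral_mul_const]

theorem BoundedEntries.meanMatrix_const_mul (hA : BoundedEntries P A) (C : Matrix ι ι ℝ) :
    meanMatrix P (fun ω => C * A ω) = C * meanMatrix P A := by
  ext a b
  simp only [meanMatrix, of_apply, mul_apply]
  rw [integral_finsetSum _ fun c _ => (hA.integrable c b).const_mul _]
  simp only [integral_const_mul]

theorem integral_trace_mul_of_indepFun (hA : BoundedEntries P A) (hB : BoundedEntries P B)
    (hAB : IndepFun A B P) :
    ∫ ω, (A ω * B ω).trace ∂P = (meanMatrix P A * meanMatrix P B).trace := by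
  have hint : ∀ a b, Integrable (fun ω => A ω a b * B ω b a) P := fun a b =>
    ((hB b a).mul (hA a b) (r := ⊤)).integrable le_top
  simp only [trace, diag, mul_apply, meanMatrix, of_apply]
  rw [integral_finsetSum _ fun a _ => integrable_finsetSum _ fun b _ => hint a b]
  refine Finset.sum_congr rfl fun a _ => ?_
  rw [integral_finsetSum _ fun b _ => hint a b]
  exact Finset.sum_congr rfl fun b _ => (hAB.comp (measurable_entry a b)
    (measurable_entry b a)).integral_fun_mul_eq_mul_integral (hA a b).1 (hB b a).1

end BoundedEntries

section Centring

variable [IsProbabilityMeasure P] {A : Ω → Matrix ι ι ℝ}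

theorem meanMatrix_const (C : Matrix ι ι ℝ) : meanMatrix P (fun _ => C) = C := by
  ext a b
  simp [meanMatrix]

theorem BoundedEntries.meanMatrix_sub_meanMatrix (hA : BoundedEntries P A) :
    meanMatrix P (fun ω => A ω - meanMatrix P A) = 0 := by
  rw [hA.meanMatrix_sub (.const _), meanMatrix_const, sub_self]

variable [Fintype ι] [DecidableEq ι]

theorem BoundedEntries.meanMatrix_sub_meanMatrix_sq (hA : BoundedEntries P A) :
    meanMatrix P (fun ω => (A ω - meanMatrix P A) ^ 2) =
      meanMatrix P (fun ω => A ω ^ 2) - meanMatrix P A ^ 2 := by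
  set M := meanMatrix P A with hM
  have hexpand : ∀ ω, (A ω - M) ^ 2 = A ω ^ 2 - A ω * M - M * (A ω - M) := fun ω => by
    rw [sq, sq, sub_mul, mul_sub]
  simp only [hexpand]
  rw [((hA.pow 2).sub (hA.mul (.const M))).meanMatrix_sub
      ((BoundedEntries.const M).mul (hA.sub (.const M))),
    (hA.pow 2).meanMatrix_sub (hA.mul (.const M)), hA.meanMatrix_mul_const,
    (hA.sub (.const M)).meanMatrix_const_mul, hA.meanMatrix_sub_meanMatrix, mul_zero, sub_zero,
    ← hM, ← sq]

theorem integral_trace_sub_meanMatrix_sq (hA : BoundedEntries P A) :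
    ∫ ω, ((A ω - meanMatrix P A) ^ 2).trace ∂P =
      ∫ ω, (A ω ^ 2).trace ∂P - (meanMatrix P A ^ 2).trace := by
  rw [((hA.sub (.const _)).pow 2).integral_trace, hA.meanMatrix_sub_meanMatrix_sq, trace_sub,
    (hA.pow 2).integral_trace]

theorem integral_trace_sub_meanMatrix_sq_le (hA : BoundedEntries P A)
    (hsymm : ∀ ω, (A ω).IsSymm) :
    ∫ ω, ((A ω - meanMatrix P A) ^ 2).trace ∂P ≤ ∫ ω, (A ω ^ 2).trace ∂P := by
  rw [integral_trace_sub_meanMatrix_sq hA]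
  exact sub_le_self _ (trace_sq_nonneg (isSymm_meanMatrix hsymm))

theorem trace_meanMatrix_sq_le (hA : BoundedEntries P A) (hsymm : ∀ ω, (A ω).IsSymm) :
    (meanMatrix P A ^ 2).trace ≤ ∫ ω, (A ω ^ 2).trace ∂P := by
  rw [← sub_nonneg, ← integral_trace_sub_meanMatrix_sq hA]
  exact integral_nonneg fun ω => trace_sq_nonneg ((hsymm ω).sub (isSymm_meanMatrix hsymm))

theorem dotProduct_meanMatrix_sub_meanMatrix_sq_le (hA : BoundedEntries P A)
    (hsymm : ∀ ω, (A ω).IsSymm) (v : ι → ℝ) :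
    v ⬝ᵥ meanMatrix P (fun ω => (A ω - meanMatrix P A) ^ 2) *ᵥ v ≤
      ∫ ω, v ⬝ᵥ A ω ^ 2 *ᵥ v ∂P := by
  have hM := dotProduct_sq_mulVec (isSymm_meanMatrix (P := P) hsymm) v
  rw [hA.meanMatrix_sub_meanMatrix_sq, sub_mulVec, dotProduct_sub, hM,
    (hA.pow 2).integral_dotProduct_mulVec]
  exact sub_le_self _ (Finset.sum_nonneg fun _ _ => mul_self_nonneg _)

end Centring

section SumOfIndependent

variable [Fintype ι] [DecidableEq ι] [IsFiniteMeasure P] {T Z : Ω → Matrix ι ι ℝ} {c : ℝ}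

theorem integral_trace_add_sq (hT : BoundedEntries P T) (hZ : BoundedEntries P Z)
    (hind : IndepFun T Z P) (hmean : meanMatrix P Z = 0) :
    ∫ ω, ((T ω + Z ω) ^ 2).trace ∂P = ∫ ω, (T ω ^ 2).trace ∂P + ∫ ω, (Z ω ^ 2).trace ∂P := by
  have hcross : ∫ ω, (T ω * Z ω).trace ∂P = 0 := by
    rw [integral_trace_mul_of_indepFun hT hZ hind, hmean, mul_zero, trace_zero]
  have hTT := (hT.pow 2).integrable_trace
  have hTZ := (hT.mul hZ).integrable_trace.const_mul 2
  simp only [trace_add_sq]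
  rw [integral_add (hTT.fun_add hTZ) (hZ.pow 2).integrable_trace, integral_add hTT hTZ,
    integral_const_mul, hcross, mul_zero, add_zero]

theorem integral_trace_sq_mul_sq_le (hT : BoundedEntries P T) (hZ : BoundedEntries P Z)
    (hTsymm : ∀ ω, (T ω).IsSymm) (hind : IndepFun T Z P)
    (hvar : ∀ v : ι → ℝ, v ⬝ᵥ meanMatrix P (fun ω => Z ω ^ 2) *ᵥ v ≤ c * (v ⬝ᵥ v)) :
    ∫ ω, (T ω ^ 2 * Z ω ^ 2).trace ∂P ≤ c * ∫ ω, (T ω ^ 2).trace ∂P := by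
  have hind2 : IndepFun (fun ω => T ω ^ 2) (fun ω => Z ω ^ 2) P :=
    hind.comp (measurable_matrix_pow 2) (measurable_matrix_pow 2)
  rw [integral_trace_mul_of_indepFun (hT.pow 2) (hZ.pow 2) hind2,
    ← (hT.pow 2).integral_trace_mul_const, ← integral_const_mul]
  exact integral_mono ((hT.pow 2).mul (.const _)).integrable_trace
    ((hT.pow 2).integrable_trace.const_mul c) fun ω => trace_sq_mul_le (hTsymm ω) hvar

theorem integral_trace_add_pow_four_le (hT : BoundedEntries P T) (hZ : BoundedEntries P Z)
    (hTsymm : ∀ ω, (T ω).IsSymm) (hZsymm : ∀ ω, (Z ω).IsSymm) (hind : IndepFun T Z P)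
    (hmean : meanMatrix P Z = 0)
    (hvar : ∀ v : ι → ℝ, v ⬝ᵥ meanMatrix P (fun ω => Z ω ^ 2) *ᵥ v ≤ c * (v ⬝ᵥ v)) :
    ∫ ω, ((T ω + Z ω) ^ 4).trace ∂P ≤ ∫ ω, (T ω ^ 4).trace ∂P +
      8 * (c * ∫ ω, (T ω ^ 2).trace ∂P) + 3 * ∫ ω, (Z ω ^ 4).trace ∂P := by
  have hcubic : ∫ ω, (T ω ^ 3 * Z ω).trace ∂P = 0 := by
    have hind3 : IndepFun (fun ω => T ω ^ 3) Z P :=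
      hind.comp (measurable_matrix_pow 3) measurable_id
    rw [integral_trace_mul_of_indepFun (hT.pow 3) hZ hind3, hmean, mul_zero, trace_zero]
  have hT4 := (hT.pow 4).integrable_trace
  have hT3Z := ((hT.pow 3).mul hZ).integrable_trace.const_mul 4
  have hT2Z2 := ((hT.pow 2).mul (hZ.pow 2)).integrable_trace.const_mul 8
  have hZ4 := (hZ.pow 4).integrable_trace.const_mul 3
  calc ∫ ω, ((T ω + Z ω) ^ 4).trace ∂P
      ≤ ∫ ω, ((T ω ^ 4).trace + 4 * (T ω ^ 3 * Z ω).trace +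
          8 * (T ω ^ 2 * Z ω ^ 2).trace + 3 * (Z ω ^ 4).trace) ∂P :=
        integral_mono ((hT.add hZ).pow 4).integrable_trace (((hT4.add hT3Z).add hT2Z2).add hZ4)
          fun ω => trace_add_pow_four_le (hTsymm ω) (hZsymm ω)
    _ = ∫ ω, (T ω ^ 4).trace ∂P + 8 * ∫ ω, (T ω ^ 2 * Z ω ^ 2).trace ∂P +
          3 * ∫ ω, (Z ω ^ 4).trace ∂P := by
        rw [integral_add ((hT4.fun_add hT3Z).fun_add hT2Z2) hZ4,
          integral_add (hT4.fun_add hT3Z) hT2Z2, integral_add hT4 hT3Z, integral_const_mul,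
          integral_const_mul, integral_const_mul, hcubic, mul_zero, add_zero]
    _ ≤ _ := by
        gcongr
        exact integral_trace_sq_mul_sq_le hT hZ hTsymm hind hvar

end SumOfIndependent

section SumOfIndependentFamily

variable {Z : κ → Ω → Matrix ι ι ℝ} {m₂ m₄ c : ℝ} {s : Finset κ} {i : κ}

theorem indepFun_sum_matrix (hind : iIndepFun Z P) (hmeas : ∀ i, Measurable (Z i)) (hi : i ∉ s) :
    IndepFun (fun ω => ∑ j ∈ s, Z j ω) (Z i) P := by
  have hsum : (∑ j ∈ s, Z j) = fun ω => ∑ j ∈ s, Z j ω := by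
    ext1 ω
    exact Finset.sum_apply ω s Z
  exact hsum ▸ hind.indepFun_finsetSum_of_notMem hmeas hi

variable [Fintype ι] [DecidableEq ι] [IsFiniteMeasure P]

theorem integral_trace_sum_sq_le (hmeas : ∀ i, Measurable (Z i))
    (hbdd : ∀ i, BoundedEntries P (Z i)) (hind : iIndepFun Z P)
    (hmean : ∀ i, meanMatrix P (Z i) = 0) (htr2 : ∀ i, ∫ ω, (Z i ω ^ 2).trace ∂P ≤ m₂)
    (s : Finset κ) : ∫ ω, ((∑ i ∈ s, Z i ω) ^ 2).trace ∂P ≤ m₂ * s.card := by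
  classical
  induction s using Finset.induction_on with
  | empty => simp
  | insert i s hi ih =>
    simp only [Finset.sum_insert hi, Finset.card_insert_of_notMem hi, add_comm (Z i _)]
    rw [integral_trace_add_sq (.sum hbdd s) (hbdd i) (indepFun_sum_matrix hind hmeas hi) (hmean i)]
    push_cast
    linarith [htr2 i]

theorem integral_trace_sum_pow_four_le (hc : 0 ≤ c) (hsymm : ∀ i ω, (Z i ω).IsSymm)
    (hmeas : ∀ i, Measurable (Z i)) (hbdd : ∀ i, BoundedEntries P (Z i)) (hind : iIndepFun Z P)
    (hmean : ∀ i, meanMatrix P (Z i) = 0)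
    (hvar : ∀ i (v : ι → ℝ), v ⬝ᵥ meanMatrix P (fun ω => Z i ω ^ 2) *ᵥ v ≤ c * (v ⬝ᵥ v))
    (htr2 : ∀ i, ∫ ω, (Z i ω ^ 2).trace ∂P ≤ m₂) (htr4 : ∀ i, ∫ ω, (Z i ω ^ 4).trace ∂P ≤ m₄)
    (s : Finset κ) :
    ∫ ω, ((∑ i ∈ s, Z i ω) ^ 4).trace ∂P ≤ 4 * c * m₂ * s.card ^ 2 + 3 * m₄ * s.card := by
  classical
  induction s using Finset.induction_on with
  | empty => simp
  | insert i s hi ih =>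
    have hm₂ : 0 ≤ m₂ := (integral_nonneg fun ω => trace_sq_nonneg (hsymm i ω)).trans (htr2 i)
    have hsq := mul_le_mul_of_nonneg_left
      (integral_trace_sum_sq_le hmeas hbdd hind hmean htr2 s) hc
    simp only [Finset.sum_insert hi, Finset.card_insert_of_notMem hi, add_comm (Z i _)]
    refine (integral_trace_add_pow_four_le (.sum hbdd s) (hbdd i)
      (fun ω => isSymm_sum (hsymm · ω) s) (hsymm i)
      (indepFun_sum_matrix hind hmeas hi) (hmean i) (hvar i)).trans ?_
    push_cast
    nlinarith [htr4 i, mul_nonneg hc hm₂]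

end SumOfIndependentFamily

end RandomMatrices

section OuterProducts

open Matrix

variable {ι α : Type*} [MeasurableSpace α] {σ : Measure α} {y : α → ι → ℝ} {c : ℝ}

/-- The outer product `y yᵀ` of a random vector, minus its expectation. -/
noncomputable def centredOuter (σ : Measure α) (y : α → ι → ℝ) (x : α) : Matrix ι ι ℝ :=
  vecMulVec (y x) (y x) - meanMatrix σ fun z => vecMulVec (y z) (y z)

theorem isSymm_vecMulVec_self (v : ι → ℝ) : (vecMulVec v v).IsSymm :=
  transpose_vecMulVec v v

theorem isSymm_centredOuter (x : α) : (centredOuter σ y x).IsSymm :=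
  (isSymm_vecMulVec_self _).sub (isSymm_meanMatrix fun _ => isSymm_vecMulVec_self _)

theorem measurable_centredOuter (hy : Measurable y) : Measurable (centredOuter σ y) :=
  measurable_of_entries fun a b =>
    (((measurable_pi_apply a).comp hy).mul ((measurable_pi_apply b).comp hy)).sub_const _

variable [Fintype ι]

theorem dotProduct_vecMulVec_self_mulVec (u v : ι → ℝ) :
    v ⬝ᵥ vecMulVec u u *ᵥ v = (v ⬝ᵥ u) ^ 2 := by
  rw [vecMulVec_mulVec, op_smul_eq_smul, dotProduct_smul, smul_eq_mul, dotProduct_comm u, sq]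

theorem boundedEntries_vecMulVec_self (hy : Measurable y) (hy1 : ∀ᵐ x ∂σ, y x ⬝ᵥ y x ≤ 1) :
    BoundedEntries σ fun x => vecMulVec (y x) (y x) := by
  have hcoord : ∀ a, MemLp (fun x => y x a) ⊤ σ := fun a => by
    refine memLp_top_of_bound ((measurable_pi_apply a).comp hy).aestronglyMeasurable 1 ?_
    filter_upwards [hy1] with x hx
    exact abs_le_one_iff_mul_self_le_one.2 ((Finset.single_le_sum
      (fun i _ => mul_self_nonneg (y x i)) (Finset.mem_univ a)).trans hx)
  exact fun a b => (hcoord b).mul (hcoord a)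

theorem boundedEntries_centredOuter [IsFiniteMeasure σ] (hy : Measurable y)
    (hy1 : ∀ᵐ x ∂σ, y x ⬝ᵥ y x ≤ 1) : BoundedEntries σ (centredOuter σ y) :=
  (boundedEntries_vecMulVec_self hy hy1).sub (.const _)

theorem dotProduct_centredOuter_mulVec [IsFiniteMeasure σ] (hy : Measurable y)
    (hy1 : ∀ᵐ x ∂σ, y x ⬝ᵥ y x ≤ 1) (v : ι → ℝ) (x : α) :
    v ⬝ᵥ centredOuter σ y x *ᵥ v = (v ⬝ᵥ y x) ^ 2 - ∫ z, (v ⬝ᵥ y z) ^ 2 ∂σ := by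
  rw [centredOuter, sub_mulVec, dotProduct_sub,
    ← (boundedEntries_vecMulVec_self hy hy1).integral_dotProduct_mulVec]
  simp only [dotProduct_vecMulVec_self_mulVec]

variable [DecidableEq ι]

theorem vecMulVec_self_sq (v : ι → ℝ) : vecMulVec v v ^ 2 = (v ⬝ᵥ v) • vecMulVec v v := by
  rw [sq, vecMulVec_mul_vecMulVec, vecMulVec_smul]

theorem trace_vecMulVec_self_sq (v : ι → ℝ) : (vecMulVec v v ^ 2).trace = (v ⬝ᵥ v) ^ 2 := by
  rw [vecMulVec_self_sq, trace_smul, trace_vecMulVec, smul_eq_mul, sq]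

theorem trace_vecMulVec_self_sq_le_one {v : ι → ℝ} (hv : v ⬝ᵥ v ≤ 1) :
    (vecMulVec v v ^ 2).trace ≤ 1 := by
  rw [trace_vecMulVec_self_sq]
  exact pow_le_one₀ (Finset.sum_nonneg fun _ _ => mul_self_nonneg _) hv

variable [IsProbabilityMeasure σ]

theorem integral_trace_vecMulVec_self_sq_le_one (hy : Measurable y)
    (hy1 : ∀ᵐ x ∂σ, y x ⬝ᵥ y x ≤ 1) : ∫ x, (vecMulVec (y x) (y x) ^ 2).trace ∂σ ≤ 1 := by
  calc ∫ x, (vecMulVec (y x) (y x) ^ 2).trace ∂σ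
      ≤ ∫ _, (1 : ℝ) ∂σ := integral_mono_ae
        ((boundedEntries_vecMulVec_self hy hy1).pow 2).integrable_trace (integrable_const _)
        (hy1.mono fun x hx => trace_vecMulVec_self_sq_le_one hx)
    _ = 1 := by simp

theorem integral_trace_centredOuter_sq_le_one (hy : Measurable y)
    (hy1 : ∀ᵐ x ∂σ, y x ⬝ᵥ y x ≤ 1) : ∫ x, (centredOuter σ y x ^ 2).trace ∂σ ≤ 1 :=
  (integral_trace_sub_meanMatrix_sq_le (boundedEntries_vecMulVec_self hy hy1)
    fun _ => isSymm_vecMulVec_self _).trans (integral_trace_vecMulVec_self_sq_le_one hy hy1)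

theorem trace_centredOuter_pow_four_le (hy : Measurable y) (hy1 : ∀ᵐ x ∂σ, y x ⬝ᵥ y x ≤ 1)
    {x : α} (hx : y x ⬝ᵥ y x ≤ 1) : (centredOuter σ y x ^ 4).trace ≤ 16 := by
  have hmean := (trace_meanMatrix_sq_le (boundedEntries_vecMulVec_self hy hy1)
    fun _ => isSymm_vecMulVec_self _).trans (integral_trace_vecMulVec_self_sq_le_one hy hy1)
  have hsq : (centredOuter σ y x ^ 2).trace ≤ 4 := by
    have := trace_sub_sq_le (isSymm_vecMulVec_self (y x))
      (isSymm_meanMatrix (P := σ) fun z => isSymm_vecMulVec_self (y z))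
    exact this.trans (by linarith [trace_vecMulVec_self_sq_le_one hx])
  calc (centredOuter σ y x ^ 4).trace
      ≤ (centredOuter σ y x ^ 2).trace ^ 2 := trace_pow_four_le (isSymm_centredOuter x)
    _ ≤ 4 ^ 2 := pow_le_pow_left₀ (trace_sq_nonneg (isSymm_centredOuter x)) hsq 2
    _ = 16 := by norm_num

theorem integral_trace_centredOuter_pow_four_le (hy : Measurable y)
    (hy1 : ∀ᵐ x ∂σ, y x ⬝ᵥ y x ≤ 1) : ∫ x, (centredOuter σ y x ^ 4).trace ∂σ ≤ 16 := by
  calc ∫ x, (centredOuter σ y x ^ 4).trace ∂σ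
      ≤ ∫ _, (16 : ℝ) ∂σ := integral_mono_ae
        ((boundedEntries_centredOuter hy hy1).pow 4).integrable_trace (integrable_const _)
        (hy1.mono fun x hx => trace_centredOuter_pow_four_le hy hy1 hx)
    _ = 16 := by simp

theorem dotProduct_meanMatrix_centredOuter_sq_le (hy : Measurable y)
    (hy1 : ∀ᵐ x ∂σ, y x ⬝ᵥ y x ≤ 1) (v : ι → ℝ) :
    v ⬝ᵥ meanMatrix σ (fun x => centredOuter σ y x ^ 2) *ᵥ v ≤ ∫ x, (v ⬝ᵥ y x) ^ 2 ∂σ := by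
  have hA := boundedEntries_vecMulVec_self hy hy1
  calc v ⬝ᵥ meanMatrix σ (fun x => centredOuter σ y x ^ 2) *ᵥ v
      ≤ ∫ x, v ⬝ᵥ vecMulVec (y x) (y x) ^ 2 *ᵥ v ∂σ :=
        dotProduct_meanMatrix_sub_meanMatrix_sq_le hA (fun _ => isSymm_vecMulVec_self _) v
    _ ≤ ∫ x, v ⬝ᵥ vecMulVec (y x) (y x) *ᵥ v ∂σ := by
        refine integral_mono_ae ((hA.pow 2).integrable_dotProduct_mulVec v)
          (hA.integrable_dotProduct_mulVec v) (hy1.mono fun x hx => ?_)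
        simp only [vecMulVec_self_sq, smul_mulVec, dotProduct_smul,
          dotProduct_vecMulVec_self_mulVec]
        exact mul_le_of_le_one_left (sq_nonneg _) hx
    _ = ∫ x, (v ⬝ᵥ y x) ^ 2 ∂σ := by simp only [dotProduct_vecMulVec_self_mulVec]

theorem integral_trace_sum_centredOuter_pow_four_le {κ : Type*} [Fintype κ] (hy : Measurable y)
    (hy1 : ∀ᵐ x ∂σ, y x ⬝ᵥ y x ≤ 1) (hc0 : 0 ≤ c)
    (hc : ∀ v : ι → ℝ, ∫ x, (v ⬝ᵥ y x) ^ 2 ∂σ ≤ c * (v ⬝ᵥ v)) :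
    ∫ ω, ((∑ i, centredOuter σ y (ω i)) ^ 4).trace ∂Measure.pi (fun _ : κ => σ) ≤
      4 * c * Fintype.card κ ^ 2 + 48 * Fintype.card κ := by
  have hm := measurable_centredOuter (σ := σ) hy
  have hb := boundedEntries_centredOuter hy hy1
  have hmean : ∀ (i : κ) {A : α → Matrix ι ι ℝ}, BoundedEntries σ A →
      meanMatrix (Measure.pi fun _ : κ => σ) (fun ω => A (ω i)) = meanMatrix σ A := fun i A hA => by
    ext a b
    exact integral_comp_eval (μ := fun _ : κ => σ) (hA a b).1
  have key := integral_trace_sum_pow_four_le (P := Measure.pi fun _ : κ => σ)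
    (Z := fun i ω => centredOuter σ y (ω i)) (m₂ := 1) (m₄ := 16) hc0
    (fun _ _ => isSymm_centredOuter _) (fun i => hm.comp (measurable_pi_apply i))
    (fun i a b => (hb a b).comp_measurePreserving (measurePreserving_eval (fun _ : κ => σ) i))
    (iIndepFun_pi (X := fun _ => centredOuter σ y) fun _ => hm.aemeasurable)
    (fun i => (hmean i hb).trans
      (boundedEntries_vecMulVec_self hy hy1).meanMatrix_sub_meanMatrix)
    (fun i v => by
      rw [hmean i (hb.pow 2)]
      exact (dotProduct_meanMatrix_centredOuter_sq_le hy hy1 v).trans (hc v))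
    (fun _ => by
      rw [integral_comp_eval (μ := fun _ : κ => σ) (f := fun x => (centredOuter σ y x ^ 2).trace)
        (hb.pow 2).integrable_trace.1]
      exact integral_trace_centredOuter_sq_le_one hy hy1)
    (fun _ => by
      rw [integral_comp_eval (μ := fun _ : κ => σ) (f := fun x => (centredOuter σ y x ^ 4).trace)
        (hb.pow 4).integrable_trace.1]
      exact integral_trace_centredOuter_pow_four_le hy hy1)
    Finset.univ
  rw [Finset.card_univ] at key
  linarith

end OuterProducts

section SpectralGap

open Module Matrix
open scoped RealInnerProductSpace

theorem frobeniusSq_eq_zero_of_finrank_eq_one {E : Type*} [NormedAddCommGroup E]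
    [InnerProductSpace ℝ E] [FiniteDimensional ℝ E] (hE : finrank ℝ E = 1) {X : E →ₗ[ℝ] E}
    (hX : X.IsSymmetric) (htr : LinearMap.trace ℝ E X = 0) : frobeniusSq X = 0 := by
  have h0 : hX.eigenvalues hE 0 = 0 := by simpa [hX.trace_eq_sum_eigenvalues hE] using htr
  simp [frobeniusSq_eq_sum_eigenvalues_sq hX hE, h0]

variable {d : ℕ} {κ : Type*} [Fintype κ]

/-- The deviation of `∑ i, y_i y_iᵀ` from its mean, for `y_i` the traceless square of `x_i` and
independent uniform unit vectors `x_i`. -/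
noncomputable def squareDeviation (x : κ → EuclideanSpace ℝ (Fin d)) :
    Matrix (Fin d × Fin d) (Fin d × Fin d) ℝ :=
  ∑ i, centredOuter (uniformSphere d 1) tracelessSquare (x i)

theorem isSymm_squareDeviation (x : κ → EuclideanSpace ℝ (Fin d)) : (squareDeviation x).IsSymm :=
  isSymm_sum (fun _ => isSymm_centredOuter _) _

theorem measurable_tracelessSquare :
    Measurable (tracelessSquare : EuclideanSpace ℝ (Fin d) → Fin d × Fin d → ℝ) :=
  continuous_tracelessSquare.measurable

variable [NeZero d]

theorem tracelessSquare_dotProduct_self_le_one_ae :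
    ∀ᵐ x ∂uniformSphere d 1, tracelessSquare x ⬝ᵥ tracelessSquare x ≤ 1 :=
  norm_eq_one_ae_uniformSphere.mono fun _ => tracelessSquare_dotProduct_self_le_one

theorem dotProduct_squareDeviation_mulVec
    {X : EuclideanSpace ℝ (Fin d) →ₗ[ℝ] EuclideanSpace ℝ (Fin d)} (hX : X.IsSymmetric)
    (htr : LinearMap.trace ℝ _ X = 0) (x : κ → EuclideanSpace ℝ (Fin d)) :
    operatorEntries X ⬝ᵥ squareDeviation x *ᵥ operatorEntries X =
      ∑ i, ⟪x i, X (x i)⟫ ^ 2 - Fintype.card κ * (2 / (d * (d + 2)) * frobeniusSq X) := by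
  simp only [squareDeviation, sum_mulVec, dotProduct_sum,
    dotProduct_centredOuter_mulVec measurable_tracelessSquare
      tracelessSquare_dotProduct_self_le_one_ae,
    operatorEntries_dotProduct_tracelessSquare, htr, zero_div, sub_zero,
    integral_inner_apply_sq hX htr, Finset.sum_sub_distrib, Finset.sum_const, Finset.card_univ,
    nsmul_eq_mul]

theorem natCast_mul_two_div_mul_frobeniusSq_le
    {X : EuclideanSpace ℝ (Fin d) →ₗ[ℝ] EuclideanSpace ℝ (Fin d)} (hX : X.IsSymmetric)
    (htr : LinearMap.trace ℝ _ X = 0) :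
    d * (2 / (d * (d + 2)) * frobeniusSq X) ≤ 1 / 2 * frobeniusSq X := by
  obtain rfl | hd := eq_or_ne d 1
  · simp [frobeniusSq_eq_zero_of_finrank_eq_one finrank_euclideanSpace_fin hX htr]
  · have hd2 : (2 : ℝ) ≤ d := by
      have := NeZero.ne d
      exact_mod_cast (show 2 ≤ d by omega)
    rw [← mul_assoc]
    refine mul_le_mul_of_nonneg_right ?_ (frobeniusSq_nonneg X)
    rw [← mul_div_assoc, div_le_div_iff₀ (by positivity) two_pos]
    nlinarith

theorem quadBound_of_squareDeviation {w : ℝ} {x : κ → EuclideanSpace ℝ (Fin d)}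
    (hc : w * Fintype.card κ = d)
    (hT : w ^ 4 * (squareDeviation x ^ 4).trace ≤ (1 / 16) ^ 4) : QuadBound w (3 / 4) x := by
  intro X hX htr
  have hF := frobeniusSq_nonneg X
  set q := operatorEntries X ⬝ᵥ squareDeviation x *ᵥ operatorEntries X with hq
  have hdev : w * q ≤ 1 / 16 * frobeniusSq X := by
    refine le_of_pow_le_pow_left₀ four_ne_zero (by positivity) ?_
    have hq4 := dotProduct_mulVec_pow_four_le (isSymm_squareDeviation x) (operatorEntries X)
    rw [operatorEntries_dotProduct_self] at hq4
    calc (w * q) ^ 4 = w ^ 4 * q ^ 4 := mul_pow ..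
      _ ≤ w ^ 4 * ((squareDeviation x ^ 4).trace * frobeniusSq X ^ 4) :=
        mul_le_mul_of_nonneg_left hq4 (by positivity)
      _ = w ^ 4 * (squareDeviation x ^ 4).trace * frobeniusSq X ^ 4 := (mul_assoc ..).symm
      _ ≤ (1 / 16) ^ 4 * frobeniusSq X ^ 4 := mul_le_mul_of_nonneg_right hT (by positivity)
      _ = (1 / 16 * frobeniusSq X) ^ 4 := (mul_pow ..).symm
  calc w * ∑ i, ⟪x i, X (x i)⟫ ^ 2
      = w * q + w * Fintype.card κ * (2 / (d * (d + 2)) * frobeniusSq X) := by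
        rw [hq, dotProduct_squareDeviation_mulVec hX htr]
        ring
    _ ≤ 1 / 16 * frobeniusSq X + 1 / 2 * frobeniusSq X := by
        rw [hc]
        exact add_le_add hdev (natCast_mul_two_div_mul_frobeniusSq_le hX htr)
    _ = (3 / 4) ^ 2 * frobeniusSq X := by ring

theorem integrable_trace_squareDeviation_pow_four :
    Integrable (fun x : κ → EuclideanSpace ℝ (Fin d) => (squareDeviation x ^ 4).trace)
      (Measure.pi fun _ => uniformSphere d 1) :=
  ((BoundedEntries.sum (fun i a b => (boundedEntries_centredOuter measurable_tracelessSquare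
    tracelessSquare_dotProduct_self_le_one_ae a b).comp_measurePreserving
      (measurePreserving_eval (fun _ => uniformSphere d 1) i)) Finset.univ).pow 4).integrable_trace

theorem integral_trace_squareDeviation_pow_four_le :
    ∫ x : κ → EuclideanSpace ℝ (Fin d), (squareDeviation x ^ 4).trace
        ∂Measure.pi (fun _ => uniformSphere d 1) ≤
      4 * (2 / (d * (d + 2))) * Fintype.card κ ^ 2 + 48 * Fintype.card κ :=
  integral_trace_sum_centredOuter_pow_four_le measurable_tracelessSquare
    tracelessSquare_dotProduct_self_le_one_ae (by positivity)
    integral_dotProduct_tracelessSquare_sq_le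

variable [Nonempty κ]

theorem pow_four_mul_integral_trace_squareDeviation_pow_four_le
    (hκ : 10 ^ 15 * (d : ℝ) ^ 4 ≤ Fintype.card κ ^ 3) :
    ((d : ℝ) / Fintype.card κ) ^ 4 * ∫ x : κ → EuclideanSpace ℝ (Fin d),
      (squareDeviation x ^ 4).trace ∂Measure.pi (fun _ => uniformSphere d 1) ≤
        (1 / 16) ^ 4 / 200 := by
  set N : ℝ := (Fintype.card κ : ℝ)
  have hd : (1 : ℝ) ≤ d := by exact_mod_cast NeZero.one_le
  have hN : 0 < N := Nat.cast_pos.2 Fintype.card_pos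
  have hw : (d : ℝ) / N ≤ 1 / 10 ^ 5 := by
    rw [div_le_div_iff₀ hN (by positivity), one_mul]
    refine le_of_pow_le_pow_left₀ three_ne_zero hN.le (le_trans ?_ hκ)
    rw [mul_pow, mul_comm, ← pow_mul]
    gcongr
    all_goals norm_num
  have hw4 : (d : ℝ) ^ 4 / N ^ 3 ≤ 1 / 10 ^ 15 := by
    rw [div_le_div_iff₀ (by positivity) (by positivity)]
    linarith
  calc (d / N : ℝ) ^ 4 * ∫ x : κ → EuclideanSpace ℝ (Fin d), (squareDeviation x ^ 4).trace
        ∂Measure.pi (fun _ => uniformSphere d 1)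
      ≤ (d / N : ℝ) ^ 4 * (4 * (2 / (d * (d + 2))) * N ^ 2 + 48 * N) :=
        mul_le_mul_of_nonneg_left integral_trace_squareDeviation_pow_four_le (by positivity)
    _ ≤ (d / N : ℝ) ^ 4 * (4 * (2 / (d * d)) * N ^ 2 + 48 * N) := by gcongr; linarith
    _ = 8 * (d / N : ℝ) ^ 2 + 48 * (d ^ 4 / N ^ 3) := by field_simp; ring
    _ ≤ 8 * (1 / 10 ^ 5) ^ 2 + 48 * (1 / 10 ^ 15) := by gcongr
    _ ≤ (1 / 16) ^ 4 / 200 := by norm_num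

theorem measureReal_not_quadBound_le (hκ : 10 ^ 15 * (d : ℝ) ^ 4 ≤ Fintype.card κ ^ 3) :
    (Measure.pi fun _ : κ => uniformSphere d 1).real
      {x | ¬ QuadBound ((d : ℝ) / Fintype.card κ) (3 / 4) x} ≤ 1 / 200 := by
  set w : ℝ := d / Fintype.card κ
  have hc : w * Fintype.card κ = d :=
    div_mul_cancel₀ _ (by exact_mod_cast Fintype.card_ne_zero)
  have hmarkov := mul_meas_ge_le_integral_of_nonneg
    (f := fun x : κ → EuclideanSpace ℝ (Fin d) => w ^ 4 * (squareDeviation x ^ 4).trace)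
    (ae_of_all _ fun x => mul_nonneg (by positivity)
      (trace_pow_four_nonneg (isSymm_squareDeviation x)))
    (integrable_trace_squareDeviation_pow_four.const_mul _) ((1 / 16) ^ 4)
  rw [integral_const_mul] at hmarkov
  calc (Measure.pi fun _ : κ => uniformSphere d 1).real {x | ¬ QuadBound w (3 / 4) x}
      ≤ (Measure.pi fun _ : κ => uniformSphere d 1).real
          {x | (1 / 16) ^ 4 ≤ w ^ 4 * (squareDeviation x ^ 4).trace} :=
        measureReal_mono fun x hx => le_of_not_ge fun h => hx (quadBound_of_squareDeviation hc h)
    _ ≤ 1 / 200 := by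
        linarith [pow_four_mul_integral_trace_squareDeviation_pow_four_le hκ]

end SpectralGap

section Nets

open Module
open scoped RealInnerProductSpace

variable {E : Type*} [NormedAddCommGroup E] [InnerProductSpace ℝ E]

theorem norm_sub_mul_norm_add_le {u v : E} (hu : ‖u‖ = 1) (hv : ‖v‖ = 1)
    (huv : ‖u - v‖ ≤ 1 / 2) : ‖u - v‖ * ‖u + v‖ ≤ 31 / 32 := by
  have hpar := parallelogram_law_with_norm ℝ u v
  rw [hu, hv] at hpar
  have hsq : ‖u - v‖ ^ 2 ≤ (1 / 2) ^ 2 := pow_le_pow_left₀ (norm_nonneg _) huv 2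
  refine le_of_pow_le_pow_left₀ two_ne_zero (by norm_num) ?_
  calc (‖u - v‖ * ‖u + v‖) ^ 2 = ‖u - v‖ ^ 2 * (4 - ‖u - v‖ ^ 2) := by
        rw [mul_pow]
        congr 1
        linarith
    _ ≤ (31 / 32) ^ 2 := by nlinarith

variable [FiniteDimensional ℝ E]

theorem card_le_of_isSeparated_sphere {N : Finset E} (hN : ∀ v ∈ N, ‖v‖ = 1)
    (hsep : Metric.IsSeparated (1 / 2 : NNReal) (N : Set E)) : N.card ≤ 5 ^ finrank ℝ E := by
  rw [← Finset.card_map ⟨fun v : E => (2 : ℝ) • v, smul_right_injective E two_ne_zero⟩]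
  refine Besicovitch.card_le_of_separated _ ?_ ?_
  · simp only [Finset.forall_mem_map]
    intro v hv
    simp [norm_smul, hN v hv]
  · simp only [Finset.forall_mem_map]
    intro u hu v hv huv
    have h : ((1 / 2 : NNReal) : ENNReal) < edist u v :=
      hsep hu hv fun h => huv (congrArg _ h)
    rw [edist_nndist, ENNReal.coe_lt_coe, ← NNReal.coe_lt_coe, coe_nndist, dist_eq_norm] at h
    push_cast at h
    simp only [Function.Embedding.coeFn_mk, ← smul_sub, norm_smul, Real.norm_two]
    linarith

theorem packingNumber_sphere_le :
    Metric.packingNumber (1 / 2) (Metric.sphere (0 : E) 1) ≤ (5 ^ finrank ℝ E : ℕ) := by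
  refine iSup₂_le fun C hC => iSup_le fun hsep => ?_
  by_contra! h
  obtain ⟨N, hNC, hN⟩ := Set.exists_subset_encard_eq (Order.add_one_le_of_lt h)
  lift N to Finset E using Set.finite_of_encard_eq_coe hN
  have hle := card_le_of_isSeparated_sphere (fun v hv => by simpa using hC (hNC hv))
    (hsep.subset hNC)
  rw [Set.encard_coe_eq_coe_finsetCard] at hN
  norm_cast at hN
  omega

theorem exists_sphere_net : ∃ N : Finset E, (∀ v ∈ N, ‖v‖ = 1) ∧ N.card ≤ 5 ^ finrank ℝ E ∧
    ∀ u : E, ‖u‖ = 1 → ∃ v ∈ N, ‖u - v‖ ≤ 1 / 2 := by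
  have hpack : Metric.packingNumber (1 / 2) (Metric.sphere (0 : E) 1) ≠ ⊤ :=
    (packingNumber_sphere_le.trans_lt (ENat.natCast_lt_top _)).ne
  have hcover := Metric.isCover_maximalSeparatedSet hpack
  have hcard := (Metric.encard_maximalSeparatedSet hpack).trans_le packingNumber_sphere_le
  have hsub := Metric.maximalSeparatedSet_subset (ε := 1 / 2) (A := Metric.sphere (0 : E) 1)
  generalize Metric.maximalSeparatedSet (1 / 2) (Metric.sphere (0 : E) 1) = N at *
  lift N to Finset E using Set.finite_of_encard_le_coe hcard
  refine ⟨N, fun v hv => by simpa using hsub hv, ?_, fun u hu => ?_⟩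
  · rw [Set.encard_coe_eq_coe_finsetCard] at hcard
    exact_mod_cast hcard
  · obtain ⟨v, hv, huv⟩ := hcover (show u ∈ Metric.sphere 0 1 by simpa using hu)
    refine ⟨v, hv, ?_⟩
    have h : edist u v ≤ ((1 / 2 : NNReal) : ENNReal) := huv
    rw [edist_nndist, ENNReal.coe_le_coe, ← NNReal.coe_le_coe, coe_nndist, dist_eq_norm] at h
    simpa only [NNReal.coe_div, NNReal.coe_one, NNReal.coe_ofNat] using h

/-- A symmetric operator attains `|⟪u, D u⟫| = ‖D‖` at some unit vector `u`, and moving `u` to a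
nearby point of the net changes the quadratic form by at most `31 / 32 * ‖D‖`. -/
theorem abs_inner_apply_self_le_of_net {D : E →ₗ[ℝ] E} (hD : D.IsSymmetric) {N : Finset E}
    (hN : ∀ v ∈ N, ‖v‖ = 1) (hnet : ∀ u : E, ‖u‖ = 1 → ∃ v ∈ N, ‖u - v‖ ≤ 1 / 2) {a : ℝ}
    (ha : ∀ v ∈ N, |⟪v, D v⟫| ≤ a) (u : E) : |⟪u, D u⟫| ≤ 32 * a * ‖u‖ ^ 2 := by
  rcases subsingleton_or_nontrivial E with hE | hE
  · simp [Subsingleton.elim u 0]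
  have hcont : Continuous D := D.continuous_of_finiteDimensional
  obtain ⟨m, hm, hmax⟩ := (isCompact_sphere (0 : E) 1).exists_isMaxOn
    ((NormedSpace.sphere_nonempty (E := E)).2 zero_le_one)
    (f := fun u => |⟪u, D u⟫|) (by fun_prop)
  rw [mem_sphere_zero_iff_norm] at hm
  set M := |⟪m, D m⟫|
  have hquad : ∀ v, |⟪v, D v⟫| ≤ M * ‖v‖ ^ 2 := fun v => by
    rcases eq_or_ne v 0 with rfl | hv
    · simp
    have hle : |⟪‖v‖⁻¹ • v, D (‖v‖⁻¹ • v)⟫| ≤ M :=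
      hmax (by simpa using norm_smul_inv_norm (𝕜 := ℝ) hv)
    rw [map_smul, inner_smul_left, inner_smul_right, ← mul_assoc, abs_mul, conj_trivial,
      abs_mul_self, ← mul_inv, inv_mul_le_iff₀ (by positivity)] at hle
    rwa [sq, mul_comm]
  obtain ⟨v, hv, hmv⟩ := hnet m hm
  have hdiff : |⟪m, D m⟫ - ⟪v, D v⟫| ≤ 31 / 32 * M := by
    have hpolar : ⟪m, D m⟫ - ⟪v, D v⟫ = ⟪m - v, D (m + v)⟫ := by
      have hsymm : ⟪m, D v⟫ = ⟪v, D m⟫ := by rw [← hD, real_inner_comm]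
      simp only [map_add, inner_sub_left, inner_add_right]
      linarith
    calc |⟪m, D m⟫ - ⟪v, D v⟫| ≤ ‖m - v‖ * ‖D (m + v)‖ :=
          hpolar ▸ abs_real_inner_le_norm _ _
      _ ≤ ‖m - v‖ * (M * ‖m + v‖) := by
          gcongr
          exact norm_apply_le_of_abs_inner_self_le hD hquad _
      _ = ‖m - v‖ * ‖m + v‖ * M := by ring
      _ ≤ 31 / 32 * M := by
          gcongr
          exact norm_sub_mul_norm_add_le hm (hN v hv) hmv
  have hMa : M ≤ 32 * a := by
    linarith [abs_sub_abs_le_abs_sub ⟪m, D m⟫ ⟪v, D v⟫, ha v hv]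
  exact (hquad u).trans (by gcongr)

end Nets

section Chernoff

theorem exp_le_one_add_add_sq_mul_exp_abs (t : ℝ) :
    Real.exp t ≤ 1 + t + t ^ 2 * Real.exp |t| := by
  have h := Complex.norm_exp_sub_sum_le_norm_mul_exp t 2
  simp only [Finset.sum_range_succ, Finset.sum_range_zero, pow_zero, Nat.factorial_zero,
    Nat.factorial_one, Nat.cast_one, div_one, pow_one, zero_add, Complex.norm_real,
    Real.norm_eq_abs, sq_abs] at h
  norm_cast at h
  linarith [(abs_le.1 h).2]

theorem exp_mul_le_one_add_add_sq_mul_exp_abs_div_four {t : ℝ} (ht : |t| ≤ 1 / 8) (s : ℝ) :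
    Real.exp (t * s) ≤ 1 + t * s + 128 * t ^ 2 * Real.exp (|s| / 4) := by
  have hts : |t * s| ≤ |s| / 8 := by
    rw [abs_mul]
    nlinarith [abs_nonneg s]
  have hs : s ^ 2 ≤ 128 * Real.exp (|s| / 8) := by
    nlinarith [Real.quadratic_le_exp_of_nonneg (x := |s| / 8) (by positivity), abs_nonneg s,
      sq_abs s]
  calc Real.exp (t * s) ≤ 1 + t * s + (t * s) ^ 2 * Real.exp |t * s| :=
        exp_le_one_add_add_sq_mul_exp_abs _
    _ ≤ 1 + t * s + (t * s) ^ 2 * Real.exp (|s| / 8) := by gcongr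
    _ = 1 + t * s + t ^ 2 * s ^ 2 * Real.exp (|s| / 8) := by ring
    _ ≤ 1 + t * s + t ^ 2 * (128 * Real.exp (|s| / 8)) * Real.exp (|s| / 8) := by gcongr
    _ = 1 + t * s + 128 * t ^ 2 * (Real.exp (|s| / 8) * Real.exp (|s| / 8)) := by ring
    _ = 1 + t * s + 128 * t ^ 2 * Real.exp (|s| / 4) := by
        rw [← Real.exp_add]
        ring_nf

variable {Ω : Type*} [MeasurableSpace Ω] {σ : Measure Ω} {f : Ω → ℝ}

theorem integrable_exp_mul_of_integrable_exp_abs_div_four (hf : Measurable f)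
    (hint : Integrable (fun x => Real.exp (|f x| / 4)) σ) {t : ℝ} (ht : |t| ≤ 1 / 8) :
    Integrable (fun x => Real.exp (t * f x)) σ := by
  refine hint.mono' (by fun_prop) (ae_of_all _ fun x => ?_)
  rw [Real.norm_eq_abs, Real.abs_exp, Real.exp_le_exp]
  refine (le_abs_self _).trans ?_
  rw [abs_mul]
  nlinarith [abs_nonneg (f x)]

variable [IsProbabilityMeasure σ]

theorem mgf_le_exp_of_integral_exp_abs_div_four_le (hf : Measurable f) (hmean : ∫ x, f x ∂σ = 0)
    (hint : Integrable (fun x => Real.exp (|f x| / 4)) σ) {b : ℝ}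
    (hb : ∫ x, Real.exp (|f x| / 4) ∂σ ≤ b) {t : ℝ} (ht : |t| ≤ 1 / 8) :
    mgf f σ t ≤ Real.exp (128 * b * t ^ 2) := by
  have hfint : Integrable f σ := by
    refine (hint.const_mul 4).mono' (by fun_prop) (ae_of_all _ fun x => ?_)
    rw [Real.norm_eq_abs]
    linarith [Real.add_one_le_exp (|f x| / 4)]
  have hlin : Integrable (fun x => 1 + t * f x) σ := (integrable_const _).add (hfint.const_mul t)
  have hexp := hint.const_mul (128 * t ^ 2)
  calc mgf f σ t ≤ ∫ x, 1 + t * f x + 128 * t ^ 2 * Real.exp (|f x| / 4) ∂σ :=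
        integral_mono (integrable_exp_mul_of_integrable_exp_abs_div_four hf hint ht)
          (hlin.add hexp) fun x => exp_mul_le_one_add_add_sq_mul_exp_abs_div_four ht (f x)
    _ = 1 + 128 * t ^ 2 * ∫ x, Real.exp (|f x| / 4) ∂σ := by
        rw [integral_add hlin hexp, integral_add (integrable_const _) (hfint.const_mul t),
          integral_const_mul, integral_const_mul, hmean]
        simp
    _ ≤ 1 + 128 * t ^ 2 * b := by gcongr
    _ ≤ Real.exp (128 * b * t ^ 2) := by linarith [Real.add_one_le_exp (128 * b * t ^ 2)]

variable {κ : Type*} [Fintype κ]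

theorem measureReal_pi_sum_ge_le (hf : Measurable f) {t s : ℝ} (ht : 0 ≤ t)
    (hint : Integrable (fun x => Real.exp (t * f x)) σ) (hmgf : mgf f σ t ≤ Real.exp s) (c : ℝ) :
    (Measure.pi fun _ : κ => σ).real {x | c ≤ ∑ i, f (x i)} ≤
      Real.exp (Fintype.card κ * s - t * c) := by
  set Y : κ → (κ → Ω) → ℝ := fun i x => f (x i)
  have hY : ∀ i, Measurable (Y i) := fun i => hf.comp (measurable_pi_apply i)
  have hindep : iIndepFun Y (Measure.pi fun _ : κ => σ) :=
    iIndepFun_pi fun _ => hf.aemeasurable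
  have hYmgf : ∀ i, mgf (Y i) (Measure.pi fun _ : κ => σ) t = mgf f σ t := fun i =>
    integral_comp_eval (μ := fun _ : κ => σ) (i := i) hint.aestronglyMeasurable
  have hsum := measure_ge_le_exp_mul_mgf c ht
    (hindep.integrable_exp_mul_sum hY (s := Finset.univ) fun i _ =>
      integrable_comp_eval (μ := fun _ : κ => σ) (i := i) hint)
  rw [hindep.mgf_sum hY] at hsum
  simp only [hYmgf, Finset.sum_apply, Finset.prod_const, Finset.card_univ] at hsum
  calc (Measure.pi fun _ : κ => σ).real {x | c ≤ ∑ i, f (x i)}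
      ≤ Real.exp (-t * c) * mgf f σ t ^ Fintype.card κ := hsum
    _ ≤ Real.exp (-t * c) * Real.exp s ^ Fintype.card κ := by
        gcongr
        exact mgf_nonneg
    _ = Real.exp (Fintype.card κ * s - t * c) := by
        rw [← Real.exp_nat_mul, ← Real.exp_add]
        ring_nf

theorem measureReal_pi_abs_sum_ge_le (hf : Measurable f) (hmean : ∫ x, f x ∂σ = 0)
    (hint : Integrable (fun x => Real.exp (|f x| / 4)) σ) {b : ℝ}
    (hb : ∫ x, Real.exp (|f x| / 4) ∂σ ≤ b) {a : ℝ} (ha0 : 0 ≤ a) (ha : a ≤ 32 * b) :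
    (Measure.pi fun _ : κ => σ).real {x | Fintype.card κ * a ≤ |∑ i, f (x i)|} ≤
      2 * Real.exp (-(Fintype.card κ * a ^ 2 / (512 * b))) := by
  have hb0 : 0 < b := (integral_exp_pos hint).trans_le hb
  have upper : ∀ g : Ω → ℝ, Measurable g → ∫ x, g x ∂σ = 0 → (∀ x, |g x| = |f x|) →
      (Measure.pi fun _ : κ => σ).real {x | Fintype.card κ * a ≤ ∑ i, g (x i)} ≤
        Real.exp (-(Fintype.card κ * a ^ 2 / (512 * b))) := by
    intro g hg hgmean hgf
    simp only [← hgf] at hint hb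
    have ht0 : 0 ≤ a / (256 * b) := by positivity
    have ht : |a / (256 * b)| ≤ 1 / 8 := by
      rw [abs_of_nonneg ht0, div_le_iff₀ (by positivity)]
      linarith
    refine (measureReal_pi_sum_ge_le hg ht0
      (integrable_exp_mul_of_integrable_exp_abs_div_four hg hint ht)
      (mgf_le_exp_of_integral_exp_abs_div_four_le hg hgmean hint hb ht) _).trans_eq ?_
    congr 1
    field_simp
    ring
  have hpos := upper f hf hmean fun _ => rfl
  have hneg := upper (fun x => -f x) hf.neg (by rw [integral_neg, hmean, neg_zero])
    fun x => abs_neg _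
  calc (Measure.pi fun _ : κ => σ).real {x | Fintype.card κ * a ≤ |∑ i, f (x i)|}
      ≤ (Measure.pi fun _ : κ => σ).real ({x | Fintype.card κ * a ≤ ∑ i, f (x i)} ∪
          {x | Fintype.card κ * a ≤ ∑ i, -f (x i)}) := by
        refine measureReal_mono fun x hx => ?_
        simpa only [Set.mem_union, Set.mem_ofPred_eq, Finset.sum_neg_distrib] using le_abs.1 hx
    _ ≤ 2 * Real.exp (-(Fintype.card κ * a ^ 2 / (512 * b))) := by
        linarith [measureReal_union_le (μ := Measure.pi fun _ : κ => σ)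
          {x | Fintype.card κ * a ≤ ∑ i, f (x i)} {x | Fintype.card κ * a ≤ ∑ i, -f (x i)}]

end Chernoff

section FrameErrorTail

open Module
open scoped RealInnerProductSpace

variable {d : ℕ}

/-- The rescaled square of the coordinate of `x` along `v`, centred so that its mean over the unit
sphere is `0` when `‖v‖ = 1`. -/
noncomputable def centredSquare (v x : EuclideanSpace ℝ (Fin d)) : ℝ := d * ⟪x, v⟫ ^ 2 - 1

theorem continuous_centredSquare (v : EuclideanSpace ℝ (Fin d)) :
    Continuous (centredSquare v) := by
  unfold centredSquare
  fun_prop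

theorem abs_centredSquare_le (v x : EuclideanSpace ℝ (Fin d)) :
    |centredSquare v x| ≤ d * ⟪x, v⟫ ^ 2 + 1 := by
  have h : 0 ≤ d * ⟪x, v⟫ ^ 2 := by positivity
  exact (abs_sub _ _).trans_eq (by rw [abs_of_nonneg h, abs_one])

theorem inner_frameError_self_eq_sum_centredSquare {κ : Type*} [Fintype κ] [Nonempty κ]
    {v : EuclideanSpace ℝ (Fin d)} (hv : ‖v‖ = 1) (x : κ → EuclideanSpace ℝ (Fin d)) :
    ⟪v, frameError ((d : ℝ) / Fintype.card κ) x v⟫ =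
      (∑ i, centredSquare v (x i)) / Fintype.card κ := by
  have hκ : (Fintype.card κ : ℝ) ≠ 0 := by exact_mod_cast Fintype.card_ne_zero
  rw [inner_frameError_self, hv]
  simp only [centredSquare, Finset.sum_sub_distrib, ← Finset.mul_sum, Finset.sum_const,
    Finset.card_univ, nsmul_eq_mul]
  field_simp

variable [NeZero d]

theorem integral_centredSquare {v : EuclideanSpace ℝ (Fin d)} (hv : ‖v‖ = 1) :
    ∫ x, centredSquare v x ∂uniformSphere d 1 = 0 := by
  have hmoment : d * sphereMoment d 1 = 1 := by
    simpa [sphereMoment_zero] using sphereMoment_succ (d := d) 0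
  have hsq : ∫ x, ⟪x, v⟫ ^ 2 ∂uniformSphere d 1 = sphereMoment d 1 := by
    simpa [hv] using integral_inner_pow v 1
  simp only [centredSquare]
  rw [integral_sub (integrable_uniformSphere (by fun_prop)) (integrable_const _),
    integral_const_mul, hsq, hmoment]
  simp

theorem integral_exp_abs_centredSquare_div_four_le {v : EuclideanSpace ℝ (Fin d)}
    (hv : ‖v‖ = 1) : ∫ x, Real.exp (|centredSquare v x| / 4) ∂uniformSphere d 1 ≤ 3 := by
  have hcont := continuous_centredSquare v
  have hquarter : Real.exp (1 / 4) ≤ 3 / 2 := by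
    linarith [(abs_le.1 (Real.abs_exp_sub_one_sub_id_le (x := 1 / 4) (by norm_num [abs_le]))).2]
  calc ∫ x, Real.exp (|centredSquare v x| / 4) ∂uniformSphere d 1
      ≤ ∫ x, Real.exp (1 / 4) * Real.exp (d * ⟪x, v⟫ ^ 2 / 4) ∂uniformSphere d 1 := by
        refine integral_mono (integrable_uniformSphere (by fun_prop))
          (integrable_uniformSphere (by fun_prop)) fun x => ?_
        simp only [← Real.exp_add, Real.exp_le_exp]
        linarith [abs_centredSquare_le v x]
    _ = Real.exp (1 / 4) * ∫ x, Real.exp (d * ⟪x, v⟫ ^ 2 / 4) ∂uniformSphere d 1 :=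
        integral_const_mul _ _
    _ ≤ 3 / 2 * 2 := by
        gcongr
        exact integral_exp_inner_sq_le hv
    _ = 3 := by norm_num

variable {κ : Type*} [Fintype κ] [Nonempty κ]

theorem measureReal_abs_inner_frameError_self_ge_le {v : EuclideanSpace ℝ (Fin d)} (hv : ‖v‖ = 1)
    {a : ℝ} (ha0 : 0 ≤ a) (ha : a ≤ 96) :
    (Measure.pi fun _ : κ => uniformSphere d 1).real
      {x | a ≤ |⟪v, frameError ((d : ℝ) / Fintype.card κ) x v⟫|} ≤
        2 * Real.exp (-(Fintype.card κ * a ^ 2 / 1536)) := by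
  have hκ : (0 : ℝ) < Fintype.card κ := by exact_mod_cast Fintype.card_pos
  have hcont := continuous_centredSquare v
  have htail := measureReal_pi_abs_sum_ge_le (κ := κ) hcont.measurable (integral_centredSquare hv)
    (integrable_uniformSphere (by fun_prop)) (integral_exp_abs_centredSquare_div_four_le hv)
    ha0 (by linarith)
  simp only [inner_frameError_self_eq_sum_centredSquare hv, abs_div, abs_of_pos hκ,
    le_div_iff₀' hκ]
  norm_num at htail ⊢
  exact htail

theorem exp_neg_fourteen_le : Real.exp (-14) ≤ 1 / 10000 := by
  rw [Real.exp_neg, one_div]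
  refine inv_anti₀ (by norm_num) ?_
  calc (10000 : ℝ) ≤ 2 ^ 14 := by norm_num
    _ ≤ Real.exp 1 ^ 14 := by
        gcongr
        linarith [Real.add_one_le_exp 1]
    _ = Real.exp 14 := by rw [← Real.exp_nat_mul]; norm_num

theorem measureReal_not_nearParseval_le {a : ℝ} (ha0 : 0 ≤ a) (ha : a ≤ 96)
    (had : 22500 * d ≤ Fintype.card κ * a ^ 2) :
    (Measure.pi fun _ : κ => uniformSphere d 1).real
      {x | ¬ NearParseval ((d : ℝ) / Fintype.card κ) (32 * a) x} ≤ 1 / 200 := by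
  set π := Measure.pi fun _ : κ => uniformSphere d 1
  set w : ℝ := (d : ℝ) / Fintype.card κ
  obtain ⟨N, hN, hcard, hnet⟩ := exists_sphere_net (E := EuclideanSpace ℝ (Fin d))
  rw [finrank_euclideanSpace_fin] at hcard
  have hsub : {x : κ → EuclideanSpace ℝ (Fin d) | ¬ NearParseval w (32 * a) x} ⊆
      ⋃ v ∈ N, {x | a ≤ |⟪v, frameError w x v⟫|} := by
    intro x hx
    by_contra! h
    simp only [Set.mem_iUnion, Set.mem_ofPred_eq, not_exists, not_le] at h
    exact hx (abs_inner_apply_self_le_of_net (frameError_isSymmetric w x) hN hnet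
      fun v hv => (h v hv).le)
  have htail : ∀ v ∈ N, π.real {x | a ≤ |⟪v, frameError w x v⟫|} ≤ 2 * (1 / 10000) ^ d := by
    intro v hv
    refine (measureReal_abs_inner_frameError_self_ge_le (hN v hv) ha0 ha).trans ?_
    calc 2 * Real.exp (-(Fintype.card κ * a ^ 2 / 1536)) ≤ 2 * Real.exp (d * (-14)) := by
          gcongr
          linarith
      _ = 2 * Real.exp (-14) ^ d := by rw [Real.exp_nat_mul]
      _ ≤ 2 * (1 / 10000) ^ d := by
          gcongr
          exact exp_neg_fourteen_le
  calc π.real {x | ¬ NearParseval w (32 * a) x}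
      ≤ ∑ v ∈ N, π.real {x | a ≤ |⟪v, frameError w x v⟫|} :=
        (measureReal_mono hsub (measure_ne_top _ _)).trans (measureReal_biUnion_finset_le _ _)
    _ ≤ ∑ _v ∈ N, 2 * (1 / 10000) ^ d := Finset.sum_le_sum htail
    _ = N.card * (2 * (1 / 10000) ^ d) := by rw [Finset.sum_const, nsmul_eq_mul]
    _ ≤ 5 ^ d * (2 * (1 / 10000) ^ d) := by
        gcongr
        exact_mod_cast hcard
    _ = 2 * (1 / 2000) ^ d := by rw [mul_left_comm, ← mul_pow]; norm_num
    _ ≤ 2 * (1 / 2000) ^ 1 := by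
        gcongr ?_ * ?_
        exact pow_le_pow_of_le_one (by norm_num) (by norm_num) NeZero.one_le
    _ ≤ 1 / 200 := by norm_num

end FrameErrorTail

section FrameMatrices

open Module Matrix
open scoped RealInnerProductSpace

variable {d n : ℕ} {x : Fin n → EuclideanSpace ℝ (Fin d)}

theorem dotProduct_frameOperator_smul_mulVec (r : ℝ) (x : Fin n → EuclideanSpace ℝ (Fin d))
    (u v : EuclideanSpace ℝ (Fin d)) :
    u.ofLp ⬝ᵥ frameOperator (fun i => r • x i) *ᵥ v.ofLp = ⟪u, frameMap (r ^ 2) x v⟫ := by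
  rw [inner_frameMap, frameOperator, sum_mulVec, dotProduct_sum, Finset.mul_sum]
  refine Finset.sum_congr rfl fun i _ => ?_
  simp only [vecMulVec_mulVec, EuclideanSpace.inner_eq_star_dotProduct, star_trivial,
    WithLp.ofLp_smul, dotProduct_smul, smul_dotProduct, op_smul_eq_smul, smul_eq_mul,
    dotProduct_comm _ (x i).ofLp]
  ring

theorem IsNearlyParseval.nearParseval {ε r : ℝ} (h : IsNearlyParseval ε fun i => r • x i) :
    NearParseval (r ^ 2) ε x := by
  intro v
  have hlower := h.1.dotProduct_mulVec_nonneg v.ofLp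
  have hupper := h.2.dotProduct_mulVec_nonneg v.ofLp
  have hv : v.ofLp ⬝ᵥ v.ofLp = ‖v‖ ^ 2 := by
    rw [← real_inner_self_eq_norm_sq, EuclideanSpace.inner_eq_star_dotProduct, star_trivial]
  simp only [star_trivial, sub_mulVec, smul_mulVec, one_mulVec, dotProduct_sub, dotProduct_smul,
    dotProduct_frameOperator_smul_mulVec, hv, smul_eq_mul] at hlower hupper
  rw [frameError, LinearMap.sub_apply, inner_sub_right, LinearMap.id_apply,
    real_inner_self_eq_norm_sq, abs_le]
  constructor <;> linarith

theorem frameOperator_smul_eq_one {r : ℝ} (h : frameMap (r ^ 2) x = LinearMap.id) :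
    frameOperator (fun i => r • x i) = 1 := by
  ext a b
  have hab := dotProduct_frameOperator_smul_mulVec r x (EuclideanSpace.single a 1)
    (EuclideanSpace.single b 1)
  rw [h, LinearMap.id_apply, EuclideanSpace.inner_single_left] at hab
  simpa [one_apply] using hab

theorem frameDist_smul (r : ℝ) (x y : Fin n → EuclideanSpace ℝ (Fin d)) :
    frameDist (fun i => r • x i) (fun i => r • y i) = r ^ 2 * ∑ i, ‖x i - y i‖ ^ 2 := by
  simp only [frameDist, ← smul_sub, norm_smul, mul_pow, Real.norm_eq_abs, sq_abs, Finset.mul_sum]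

/-- The properties of a sample of points on the unit sphere which make the scaling iteration
converge and which hold with high probability. For `n` independent uniform points, the deviation of
the frame operator from the identity is of order `√(d / n)`; the factor `4800` makes larger
deviations rare. -/
structure IsWellConditioned {κ : Type*} [Fintype κ] (x : κ → EuclideanSpace ℝ (Fin d)) : Prop where
  norm_eq_one (i : κ) : ‖x i‖ = 1
  nearParseval : NearParseval ((d : ℝ) / Fintype.card κ) (4800 * √(d / Fintype.card κ)) x
  quadBound : QuadBound ((d : ℝ) / Fintype.card κ) (3 / 4) x

theorem pow_six_mul_le_of_le_pow_three {a b : ℝ} (ha : 0 ≤ a) (hb : 0 < b)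
    (h : (10 ^ 15) ^ 3 * a ^ 4 ≤ b ^ 3) : (4800 * √(a / b)) ^ 6 * a ≤ (1 / 4000) ^ 6 := by
  calc (4800 * √(a / b)) ^ 6 * a = 4800 ^ 6 * (√(a / b) ^ 2) ^ 3 * a := by ring
    _ = 4800 ^ 6 * a ^ 4 / b ^ 3 := by rw [Real.sq_sqrt (by positivity)]; ring
    _ ≤ (1 / 4000) ^ 6 := by
      have ha4 : 0 ≤ a ^ 4 := by positivity
      rw [div_le_iff₀ (by positivity)]
      linarith

theorem IsWellConditioned.exists_isDoublyBalanced [NeZero d] [Nonempty (Fin n)]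
    (hx : IsWellConditioned x) (hdn : (10 ^ 15) ^ 3 * (d : ℝ) ^ 4 ≤ n ^ 3) {ε : ℝ}
    (hε : IsNearlyParseval ε fun i => √((d : ℝ) / n) • x i) :
    ∃ V : Fin n → EuclideanSpace ℝ (Fin d), IsDoublyBalanced V ∧
      frameDist (fun i => √((d : ℝ) / n) • x i) V ≤ 125 * d * ε ^ 2 := by
  have hn : (0 : ℝ) < n := by exact_mod_cast Fin.pos_iff_nonempty.2 ‹_›
  have hd : (1 : ℝ) ≤ d := by exact_mod_cast NeZero.one_le
  have hw : 0 < (d : ℝ) / n := by positivity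
  have hr : √((d : ℝ) / n) ^ 2 = d / n := Real.sq_sqrt hw.le
  obtain ⟨hnorm, hparseval, hquad⟩ := hx
  rw [Fintype.card_fin] at hparseval hquad
  have hed := pow_six_mul_le_of_le_pow_three d.cast_nonneg hn hdn
  have he : 4800 * √((d : ℝ) / n) ≤ 1 / 4000 :=
    le_of_pow_le_pow_left₀ (by norm_num : 6 ≠ 0) (by norm_num)
      ((le_mul_of_one_le_right (by positivity) hd).trans hed)
  obtain ⟨z, hz, hid, hdist⟩ := hparseval.exists_frameMap_eq_id hw (he.trans (by norm_num)) hnorm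
    (by rwa [finrank_euclideanSpace_fin])
    (by rw [Fintype.card_fin, finrank_euclideanSpace_fin, div_mul_cancel₀ _ hn.ne']) hquad
  refine ⟨fun i => √((d : ℝ) / n) • z i,
    ⟨frameOperator_smul_eq_one (by rw [hr, hid]), fun i => ?_⟩, ?_⟩
  · rw [norm_smul, hz, mul_one, Real.norm_eq_abs, sq_abs, hr]
  · have hF := hε.nearParseval.frobeniusSq_frameError_le
    rw [hr, finrank_euclideanSpace_fin] at hF
    rw [frameDist_smul, hr]
    linarith

end FrameMatrices

section RandomFrame

variable {d n : ℕ}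

theorem exists_measurableSet_of_hasLaw {Ω 𝓧 : Type*} [MeasurableSpace Ω] [MeasurableSpace 𝓧]
    {P : Measure Ω} [IsProbabilityMeasure P] {μ : Measure 𝓧} [IsFiniteMeasure μ] {X : Ω → 𝓧}
    (hX : HasLaw X μ P) {p : 𝓧 → Prop} {δ : ℝ} (hp : μ.real {x | ¬ p x} ≤ δ) :
    ∃ E : Set Ω, MeasurableSet E ∧ 1 - δ ≤ P.real E ∧ ∀ ω ∈ E, p (X ω) := by
  set B := X ⁻¹' {x | ¬ p x}
  have hB : P.real B ≤ μ.real {x | ¬ p x} := by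
    refine ENNReal.toReal_mono (measure_ne_top _ _) ?_
    rw [← hX.map_eq]
    exact Measure.le_map_apply hX.aemeasurable _
  refine ⟨(toMeasurable P B)ᶜ, (measurableSet_toMeasurable _ _).compl, ?_, fun ω hω => ?_⟩
  · rw [probReal_compl_eq_one_sub (measurableSet_toMeasurable _ _), measureReal_def,
      measure_toMeasurable, ← measureReal_def]
    linarith
  · by_contra h
    exact hω (subset_toMeasurable P B h)

theorem hasLaw_inv_smul_uniformSphere {Ω : Type*} [MeasurableSpace Ω] {P : Measure Ω} {r : ℝ}
    (hr : r ≠ 0) {u : Ω → EuclideanSpace ℝ (Fin d)} (hu : HasLaw u (uniformSphere d r) P) :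
    HasLaw (fun ω => r⁻¹ • u ω) (uniformSphere d 1) P := by
  refine HasLaw.fun_comp (Y := fun x => r⁻¹ • x) ⟨by fun_prop, ?_⟩ hu
  rw [← map_smul_uniformSphere r, Measure.map_map (by fun_prop) (by fun_prop)]
  simp [Function.comp_def, smul_smul, hr]

theorem hasLaw_pi_inv_smul_uniformSphere {κ Ω : Type*} [Fintype κ] [MeasurableSpace Ω]
    {P : Measure Ω} {r : ℝ} (hr : r ≠ 0)
    {U : κ → Ω → EuclideanSpace ℝ (Fin d)} (hU : ∀ i, HasLaw (U i) (uniformSphere d r) P)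
    (hind : iIndepFun U P) :
    HasLaw (fun ω i => r⁻¹ • U i ω) (Measure.pi fun _ => uniformSphere d 1) P :=
  (hind.comp (fun _ x => r⁻¹ • x) fun _ => by fun_prop).hasLaw_pi fun i =>
    hasLaw_inv_smul_uniformSphere hr (hU i)

variable [NeZero d] {κ : Type*} [Fintype κ]

theorem norm_eq_one_ae_pi_uniformSphere :
    ∀ᵐ x : κ → EuclideanSpace ℝ (Fin d) ∂Measure.pi fun _ => uniformSphere d 1, ∀ i, ‖x i‖ = 1 :=
  ae_all_iff.2 fun i =>
    (measurePreserving_eval (fun _ : κ => uniformSphere d 1) i).quasiMeasurePreserving.ae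
      norm_eq_one_ae_uniformSphere

theorem measureReal_not_isWellConditioned_le [Nonempty κ]
    (hκ : 10 ^ 15 * (d : ℝ) ^ 4 ≤ Fintype.card κ ^ 3) :
    (Measure.pi fun _ : κ => uniformSphere d 1).real {x | ¬ IsWellConditioned x} ≤ 1 / 100 := by
  set μ := Measure.pi fun _ : κ => uniformSphere d 1
  set w : ℝ := d / Fintype.card κ
  set A : Set (κ → EuclideanSpace ℝ (Fin d)) := {x | ¬ ∀ i, ‖x i‖ = 1}
  set B : Set (κ → EuclideanSpace ℝ (Fin d)) := {x | ¬ NearParseval w (4800 * √w) x}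
  set C : Set (κ → EuclideanSpace ℝ (Fin d)) := {x | ¬ QuadBound w (3 / 4) x}
  have hd : (1 : ℝ) ≤ d := by exact_mod_cast NeZero.one_le
  have hw : √w ^ 2 = w := Real.sq_sqrt (by positivity)
  have hw1 : √w ≤ 1 / 100 := by
    refine le_of_pow_le_pow_left₀ (by norm_num : 6 ≠ 0) (by norm_num) ?_
    rw [show √w ^ 6 = (√w ^ 2) ^ 3 by ring, hw, div_pow, div_le_iff₀ (by positivity)]
    linarith [pow_le_pow_right₀ hd (by norm_num : 3 ≤ 4), pow_pos (zero_lt_one.trans_le hd) 4]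
  have hA : μ.real A = 0 := by
    rw [measureReal_def, ae_iff.1 norm_eq_one_ae_pi_uniformSphere, ENNReal.toReal_zero]
  have hB : μ.real B ≤ 1 / 200 := by
    have h := measureReal_not_nearParseval_le (d := d) (κ := κ) (a := 150 * √w) (by positivity)
      (by linarith) (by rw [mul_pow, hw]; simp only [w]; field_simp; norm_num)
    rwa [← mul_assoc, show (32 * 150 : ℝ) = 4800 by norm_num] at h
  have hC : μ.real C ≤ 1 / 200 := measureReal_not_quadBound_le hκ
  calc μ.real {x | ¬ IsWellConditioned x} ≤ μ.real (A ∪ (B ∪ C)) := by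
        refine measureReal_mono (fun x hx => ?_)
        by_contra h
        simp only [A, B, C, Set.mem_union, Set.mem_ofPred_eq, not_or, not_not] at h
        exact hx ⟨h.1, h.2.1, h.2.2⟩
    _ ≤ μ.real A + (μ.real B + μ.real C) :=
        (measureReal_union_le _ _).trans (add_le_add_right (measureReal_union_le _ _) _)
    _ ≤ 1 / 100 := by linarith

end RandomFrame

theorem mul_pow_four_le_pow_three {K a b : ℝ} (hK : 0 ≤ K) (ha : 0 ≤ a)
    (h : K * a ^ (4 / 3 : ℝ) ≤ b) : K ^ 3 * a ^ 4 ≤ b ^ 3 := by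
  calc K ^ 3 * a ^ 4 = (K * a ^ (4 / 3 : ℝ)) ^ 3 := by
        rw [mul_pow, ← Real.rpow_mul_natCast ha, ← Real.rpow_natCast a 4]
        norm_num
    _ ≤ b ^ 3 := by gcongr

theorem theoremt :
    ∃ K C : ℝ, 0 < K ∧ 0 < C ∧
      ∀ (d n : ℕ), 1 ≤ d → K * (d : ℝ) ^ (4 / 3 : ℝ) ≤ (n : ℝ) →
      ∀ {Ω : Type*} [MeasurableSpace Ω] (P : Measure Ω) [IsProbabilityMeasure P]
        (U : Fin n → Ω → EuclideanSpace ℝ (Fin d)),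
        (∀ i, HasLaw (U i) (uniformSphere d (Real.sqrt ((d : ℝ) / n))) P) →
        iIndepFun U P →
        ∃ E : Set Ω, MeasurableSet E ∧ (0.99 : ℝ) ≤ P.real E ∧
          ∀ ω ∈ E, ∀ ε : ℝ, IsNearlyParseval ε (fun i => U i ω) →
            ∃ V : Fin n → EuclideanSpace ℝ (Fin d),
              IsDoublyBalanced V ∧ frameDist (fun i => U i ω) V ≤ C * d * ε ^ 2 := by
  refine ⟨10 ^ 15, 125, by norm_num, by norm_num, fun d n hd hn Ω _ P _ U hU hind => ?_⟩
  have : NeZero d := ⟨by omega⟩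
  have hd0 : (0 : ℝ) < d := by exact_mod_cast hd
  have hn0 : (0 : ℝ) < n := lt_of_lt_of_le (by positivity) hn
  have : Nonempty (Fin n) := Fin.pos_iff_nonempty.1 (by exact_mod_cast hn0)
  have hr : √((d : ℝ) / n) ≠ 0 := by positivity
  have hdn := mul_pow_four_le_pow_three (by norm_num) hd0.le hn
  obtain ⟨E, hE, hPE, hgood⟩ := exists_measurableSet_of_hasLaw
    (hasLaw_pi_inv_smul_uniformSphere hr hU hind)
    (measureReal_not_isWellConditioned_le (by rw [Fintype.card_fin]; linarith [pow_pos hd0 4]))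
  refine ⟨E, hE, by norm_num at hPE ⊢; exact hPE, fun ω hω ε hε => ?_⟩
  have hscale : (fun i => U i ω) = fun i => √((d : ℝ) / n) • (√((d : ℝ) / n))⁻¹ • U i ω := by
    simp only [smul_inv_smul₀ hr]
  rw [hscale] at hε ⊢
  exact (hgood ω hω).exists_isDoublyBalanced hdn hε
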